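/- Let $k$ be a finite field with $q$ elements, $A=k[t]$, $F=k(t)$, where $t$ is the standard coordinate on $\mathbf{P}^1=\mathbf{P}^1_k$, so that $\operatorname{Spec}A=\mathbf{P}^1\setminus\{\infty\}$. Let $X$ be a smooth projective geometrically connected (integral) curve over $k$ with function field $K$, let $\pi\colon X\to\mathbf{P}^1$ be a surjective morphism over $k$, and let $Y=\pi^{-1}(\operatorname{Spec}A)\subset X$. For $z\in X\setminus Y$ let $K_z$ be the completion of $K$ at $z$. For an $A$-algebra $R$ let $C_0(R)$ be the additive group of $R$ with the $A$-module structure that is $k$-linear and in which $t$ acts by $c\mapsto tc+c^q$; for an open $V\subset Y$ put $C_0(V)=C_0(\Gamma(V,\mathcal{O}_X))$. Let $\exp x=x+e_1x^q+e_2x^{q^2}+\cdots\in F[[x]]$ be the unique power series of this form with $\exp(tx)=t\exp x+(\exp x)^q$. Let $C$ be the sheaf of $A$-modules on $X$ (for the Zariski topology) given by $$C(U)=\Big\{(c,(\gamma_z)_z)\in C_0(U\cap Y)\times\prod_{z\in U\setminus Y}K_z \;\Big|\; \exp\gamma_z=c \text{ in } C_0(K_z) \text{ for all } z\Big\}.$$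 Then for every $z\in X\setminus Y$ the series $\exp$ converges on all of $K_z$, the map $$\delta\colon C_0(Y)\times\prod_{z\in X\setminus Y}K_z\to\prod_{z\in X\setminus Y}C_0(K_z),\qquad (c,(\gamma_z)_z)\mapsto(c-\exp\gamma_z)_z$$ is $A$-linear, and there is an exact sequence of $A$-modules $$0\to C(X)\to C_0(Y)\times\prod_{z\in X\setminus Y}K_z\xrightarrow{\ \delta\ }\prod_{z\in X\setminus Y}C_0(K_z)\to H^1(X,C)\to 0$$ in which the first map is the inclusion. -/

import Mathlib

open CategoryTheory AlgebraicGeometry TopologicalSpace Opposite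

universe u

noncomputable section

attribute [local instance] MvPolynomial.gradedAlgebra

namespace Carlitz

/-! ### Projective space over a field -/

/-- Projective `n`-space `Proj k[x₀, …, xₙ]` over `k`. -/
def ProjSpace (n : ℕ) (k : Type u) [Field k] : Scheme.{u} :=
  Proj (MvPolynomial.homogeneousSubmodule (Fin (n + 1)) k)

/-- The structure morphism of projective `n`-space. -/
def ProjSpace.toSpec (n : ℕ) (k : Type u) [Field k] : ProjSpace n k ⟶ Spec (.of k) :=
  Proj.toSpecZero (MvPolynomial.homogeneousSubmodule (Fin (n + 1)) k) ≫
    Spec.map (CommRingCat.ofHom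
      (algebraMap k (MvPolynomial.homogeneousSubmodule (Fin (n + 1)) k 0)))

/-- A `k`-scheme is projective if it is a closed subscheme of some projective space over `k`. -/
def IsProjective {k : Type u} [Field k] {X : Scheme.{u}} (p : X ⟶ Spec (.of k)) : Prop :=
  ∃ (n : ℕ) (i : X ⟶ ProjSpace n k), IsClosedImmersion i ∧ i ≫ ProjSpace.toSpec n k = p

section P1

variable (k : Type u) [Field k]

/-- The affine line `𝐏¹ - ∞ = D₊(x₀)`; the point at infinity is `x₀ = 0`. -/
def affineLine : (ProjSpace 1 k).Opens :=
  Proj.basicOpen (MvPolynomial.homogeneousSubmodule (Fin 2) k) (MvPolynomial.X 0)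

lemma X_mem (i : Fin 2) : (MvPolynomial.X i : MvPolynomial (Fin 2) k) ∈
    MvPolynomial.homogeneousSubmodule (Fin 2) k 1 :=
  MvPolynomial.isHomogeneous_X k i

/-- The coordinate `t = x₁ / x₀`. -/
def coordAway : HomogeneousLocalization.Away (MvPolynomial.homogeneousSubmodule (Fin 2) k)
    (MvPolynomial.X (0 : Fin 2)) :=
  HomogeneousLocalization.Away.mk (MvPolynomial.homogeneousSubmodule (Fin 2) k)
    (d := 1) (X_mem k 0) 1 (MvPolynomial.X 1)
    (by simpa only [one_smul] using X_mem k 1)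

/-- The map `k[t] → (k[x₀, x₁][1/x₀])₀`. -/
def polyToAway : Polynomial k →+*
    HomogeneousLocalization.Away (MvPolynomial.homogeneousSubmodule (Fin 2) k)
      (MvPolynomial.X (0 : Fin 2)) :=
  Polynomial.eval₂RingHom
    ((HomogeneousLocalization.fromZeroRingHom
      (MvPolynomial.homogeneousSubmodule (Fin 2) k) _).comp
      (algebraMap k (MvPolynomial.homogeneousSubmodule (Fin 2) k 0)))
    (coordAway k)

/-- The map `A = k[t] → Γ(𝐏¹ - ∞, 𝒪)` sending the variable to the coordinate `t`. -/
def polyToSections : Polynomial k →+* Γ(ProjSpace 1 k, affineLine k) :=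
  (Proj.awayToSection (MvPolynomial.homogeneousSubmodule (Fin 2) k)
    (MvPolynomial.X 0)).hom.comp (polyToAway k)

lemma polyToAway_injective : Function.Injective (polyToAway k) := by
  have hu : IsUnit (MvPolynomial.aeval (R := k) (fun i : Fin 2 => if i = 0 then 1 else
      (Polynomial.X : Polynomial k)) (MvPolynomial.X (0 : Fin 2))) := by simp
  let r : Localization.Away (MvPolynomial.X (0 : Fin 2) : MvPolynomial (Fin 2) k) →+*
      Polynomial k := IsLocalization.Away.lift _ (g := (MvPolynomial.aeval (R := k)
        (fun i : Fin 2 => if i = 0 then 1 else (Polynomial.X : Polynomial k))).toRingHom) hu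
  have key : (r.comp (algebraMap _ _)).comp (polyToAway k) = RingHom.id _ := by
    refine Polynomial.ringHom_ext (fun a => ?_) ?_
    · simp only [polyToAway, RingHom.comp_apply, Polynomial.coe_eval₂RingHom,
        Polynomial.eval₂_C, RingHom.id_apply]
      change r (HomogeneousLocalization.val (HomogeneousLocalization.fromZeroRingHom
        (MvPolynomial.homogeneousSubmodule (Fin 2) k) _ _)) = _
      change r (Localization.mk (MvPolynomial.C a) 1) = _
      rw [Localization.mk_one_eq_algebraMap]
      simp [r, IsLocalization.Away.lift_eq]
    · simp only [polyToAway, RingHom.comp_apply, Polynomial.coe_eval₂RingHom,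
        Polynomial.eval₂_X, RingHom.id_apply]
      change r (HomogeneousLocalization.val (coordAway k)) = _
      rw [coordAway, HomogeneousLocalization.Away.val_mk, Localization.mk_eq_mk']
      refine (IsLocalization.lift_mk'_spec _ _ _ _).mpr ?_
      simp
  intro a b h
  have := congrArg (r.comp (algebraMap _ _)) h
  rw [← RingHom.comp_apply, ← RingHom.comp_apply, key] at this
  simpa using this

lemma polyToSections_injective : Function.Injective (polyToSections k) := by
  intro a b h
  apply polyToAway_injective k
  have e := Proj.basicOpenIsoAway (MvPolynomial.homogeneousSubmodule (Fin 2) k)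
    (f := MvPolynomial.X 0) (X_mem k 0) one_pos
  have hi : IsIso (Proj.awayToSection (MvPolynomial.homogeneousSubmodule (Fin 2) k)
    (MvPolynomial.X 0)) := by
    rw [← Proj.basicOpenIsoAway_hom (MvPolynomial.homogeneousSubmodule (Fin 2) k)
      (f := MvPolynomial.X 0) (X_mem k 0) one_pos]
    infer_instance
  exact ((ConcreteCategory.isIso_iff_bijective _).mp hi).1 h

lemma basicOpen_polyToSections_ne_bot {a : Polynomial k} (ha : a ≠ 0) :
    (ProjSpace 1 k).basicOpen (polyToSections k a) ≠ ⊥ := by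
  have hc : IsCompact ((affineLine k : (ProjSpace 1 k).Opens) : Set (ProjSpace 1 k)) :=
    (Proj.isAffineOpen_basicOpen (MvPolynomial.homogeneousSubmodule (Fin 2) k)
      (f := MvPolynomial.X 0) (X_mem k 0) one_pos).isCompact
  rw [Ne, ← Scheme.isNilpotent_iff_basicOpen_eq_bot_of_isCompact hc]
  rintro ⟨n, hn⟩
  rw [← map_pow, map_eq_zero_iff _ (polyToSections_injective k)] at hn
  exact ha (pow_eq_zero_iff (n := n) (by rintro rfl; simp at hn) |>.mp hn)

end P1

/-! ### The Carlitz module -/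

section CarlitzModule

variable (k : Type u) [Field k] [Fintype k] (R : Type u) [CommRing R] [Algebra (Polynomial k) R]

/-- The `q`-power map of a `k[t]`-algebra, where `q = #k`. -/
def frob : R →+* R :=
  letI : Algebra k R := ((algebraMap (Polynomial k) R).comp Polynomial.C).toAlgebra
  (FiniteField.frobeniusAlgHom k R).toRingHom

lemma frob_apply (c : R) : frob k R c = c ^ Fintype.card k := rfl

lemma frob_algebraMap_C (a : k) :
    frob k R (algebraMap (Polynomial k) R (Polynomial.C a)) =
      algebraMap (Polynomial k) R (Polynomial.C a) := by
  rw [frob_apply, ← map_pow, ← map_pow, FiniteField.pow_card]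

/-- The additive endomorphism `c ↦ t c + c ^ q`. -/
def tAction : AddMonoid.End R :=
  AddMonoidHom.mulLeft (algebraMap (Polynomial k) R Polynomial.X) + (frob k R).toAddMonoidHom

/-- The ring homomorphism `φ : k[t] → End R`, `k`-linear with `φ t = (c ↦ t c + c ^ q)`. -/
def action : Polynomial k →+* AddMonoid.End R :=
  Polynomial.eval₂RingHom'
    (((Module.toAddMonoidEnd R R).comp (algebraMap (Polynomial k) R)).comp Polynomial.C)
    (tAction k R) (by
      intro a
      refine AddMonoidHom.ext fun c => ?_
      change algebraMap (Polynomial k) R (Polynomial.C a) *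
          (algebraMap (Polynomial k) R Polynomial.X * c + frob k R c) =
        algebraMap (Polynomial k) R Polynomial.X *
            (algebraMap (Polynomial k) R (Polynomial.C a) * c) +
          frob k R (algebraMap (Polynomial k) R (Polynomial.C a) * c)
      rw [map_mul, frob_algebraMap_C]
      ring)

/-- The Carlitz module `C₀(R)` of a `k[t]`-algebra `R`: the additive group of `R`, with `k[t]`
acting through `action`. -/
@[nolint unusedArguments]
def C0 (k : Type u) [Field k] [Fintype k] (R : Type u) [CommRing R] [Algebra (Polynomial k) R] :
    Type u := R

instance : AddCommGroup (C0 k R) := inferInstanceAs (AddCommGroup R)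

instance : Module (Polynomial k) (C0 k R) :=
  letI : Module (AddMonoid.End R) (C0 k R) := inferInstanceAs (Module (AddMonoid.End R) R)
  Module.compHom (C0 k R) (action k R)

/-- The identity map from `R` to `C₀(R)`. -/
def toC0 : R ≃+ C0 k R := AddEquiv.refl R

lemma C_smul_toC0 (a : k) (c : R) : Polynomial.C a • toC0 k R c =
    toC0 k R (algebraMap (Polynomial k) R (Polynomial.C a) * c) := by
  change action k R (Polynomial.C a) c = _
  simp only [action, Polynomial.eval₂RingHom', RingHom.coe_mk, MonoidHom.coe_mk, OneHom.coe_mk,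
    Polynomial.eval₂_C]
  rfl

lemma X_smul_toC0 (c : R) : (Polynomial.X : Polynomial k) • toC0 k R c =
    toC0 k R (algebraMap (Polynomial k) R Polynomial.X * c + c ^ Fintype.card k) := by
  change action k R Polynomial.X c = _
  simp only [action, Polynomial.eval₂RingHom', RingHom.coe_mk, MonoidHom.coe_mk, OneHom.coe_mk,
    Polynomial.eval₂_X]
  rfl

variable {R} {S : Type u} [CommRing S] [Algebra (Polynomial k) S]

/-- Functoriality of `C₀`. -/
def C0.map (f : R →ₐ[Polynomial k] S) : C0 k R →ₗ[Polynomial k] C0 k S where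
  toFun c := toC0 k S (f ((toC0 k R).symm c))
  map_add' a b := by simp
  map_smul' a c := by
    obtain ⟨c, rfl⟩ := (toC0 k R).surjective c
    induction a using Polynomial.induction_on generalizing c with
    | C a => simp [C_smul_toC0]
    | add p r hp hr => simp only [add_smul, map_add, hp, hr]
    | monomial n a h =>
      have h1 : ∀ c, (toC0 k S (f ((toC0 k R).symm ((Polynomial.X : Polynomial k) •
          toC0 k R c)))) = (Polynomial.X : Polynomial k) • toC0 k S (f c) := by
        intro c
        simp [X_smul_toC0]
      have e : (Polynomial.C a * Polynomial.X ^ (n + 1) : Polynomial k) =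
        (Polynomial.C a * Polynomial.X ^ n) * Polynomial.X := by ring
      rw [e, mul_smul, X_smul_toC0, h, RingHom.id_apply, RingHom.id_apply,
       
        mul_smul _ _ (toC0 k S (f ((toC0 k R).symm (toC0 k R c)))), AddEquiv.symm_apply_apply (toC0 k R) c,
        ← h1, X_smul_toC0]

lemma C0.map_toC0 (f : R →ₐ[Polynomial k] S) (c : R) :
    C0.map k f (toC0 k R c) = toC0 k S (f c) := rfl

/-- The coefficients `e₀ = 1, e₁, e₂, …` of the Carlitz exponential `∑ eᵢ x ^ (q ^ i)`, in a field
extension `L` of `k(t)`; they are determined by `exp (t x) = t exp x + (exp x) ^ q`. -/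
def expCoeff (L : Type u) [Field L] [Algebra (Polynomial k) L] : ℕ → L
  | 0 => 1
  | i + 1 => expCoeff L i ^ Fintype.card k /
      (algebraMap (Polynomial k) L Polynomial.X ^ Fintype.card k ^ (i + 1) -
        algebraMap (Polynomial k) L Polynomial.X)

end CarlitzModule

/-! ### The topology of a fraction field -/

section Topology

variable (R K : Type u) [CommRing R] [Field K] [Algebra R K]

/-- The fractional ideal `a R` in `K`. -/
def fracNhd (a : Kˣ) : AddSubgroup K :=
  (algebraMap R K).range.toAddSubgroup.map (AddMonoidHom.mulLeft (a : K))

variable {R K} in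
lemma mem_fracNhd {a : Kˣ} {x : K} : x ∈ fracNhd R K a ↔ ∃ r : R, (a : K) * algebraMap R K r = x := by
  simp [fracNhd, AddSubgroup.mem_map]

/-- The fractional ideals `a R`, `a ≠ 0`, form a basis of neighbourhoods of zero for a ring
topology on the fraction field `K` of `R`. If `R` is a discrete valuation ring, this is the
topology given by the valuation. -/
lemma fracBasis [IsFractionRing R K] : RingSubgroupsBasis (fracNhd R K) := by
  have hfrac : ∀ x : K, ∃ r s : R, algebraMap R K s ≠ 0 ∧ x * algebraMap R K s = algebraMap R K r := by
    intro x
    obtain ⟨r, s, hs, rfl⟩ := IsFractionRing.div_surjective (A := R) x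
    have : algebraMap R K s ≠ 0 := by
      have := IsLocalization.map_units K ⟨s, hs⟩
      exact this.ne_zero
    exact ⟨r, s, this, div_mul_cancel₀ _ this⟩
  apply RingSubgroupsBasis.of_comm
  · intro a b
    obtain ⟨r, s, hs, h⟩ := hfrac ((a : K) / b)
    refine ⟨a * Units.mk0 _ hs, ?_⟩
    intro x hx
    obtain ⟨y, rfl⟩ := mem_fracNhd.mp hx
    refine ⟨mem_fracNhd.mpr ⟨s * y, by simp [mul_assoc]⟩, mem_fracNhd.mpr ⟨r * y, ?_⟩⟩
    have hb := b.ne_zero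
    rw [map_mul, ← h]
    simp
    field_simp
  · intro a
    obtain ⟨r, s, hs, h⟩ := hfrac (a : K)
    refine ⟨Units.mk0 _ hs * a, ?_⟩
    rintro _ ⟨x, hx, y, hy, rfl⟩
    obtain ⟨x, rfl⟩ := mem_fracNhd.mp hx
    obtain ⟨y, rfl⟩ := mem_fracNhd.mp hy
    refine mem_fracNhd.mpr ⟨s * r * x * y, ?_⟩
    simp only [map_mul, ← h, Units.val_mul, Units.val_mk0]
    ring
  · intro x a
    obtain ⟨r, s, hs, h⟩ := hfrac x
    refine ⟨Units.mk0 _ hs * a, ?_⟩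
    intro y hy
    obtain ⟨y, rfl⟩ := mem_fracNhd.mp hy
    refine mem_fracNhd.mpr ⟨r * y, ?_⟩
    simp only [map_mul, ← h, Units.val_mul, Units.val_mk0]
    ring

end Topology

/-! ### Curves over the projective line -/

section Curve

variable {k : Type u} [Field k] {X : Scheme.{u}} (π : X ⟶ ProjSpace 1 k)

/-- The inverse image `Y ⊆ X` of the affine line `𝐏¹ - ∞`. -/
def finitePart : X.Opens := π ⁻¹ᵁ affineLine k

/-- The points of `X` above `∞`. -/
abbrev AtInfty : Type u := {z : X // z ∉ finitePart π}

/-- The ring `Γ(V, 𝒪_X)` for an open `V ⊆ Y`, to be viewed as a `k[t]`-algebra through `π`. -/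
@[nolint unusedArguments]
def Sec (V : X.Opens) (_hV : V ≤ finitePart π) : Type u := Γ(X, V)

instance (V : X.Opens) (hV : V ≤ finitePart π) : CommRing (Sec π V hV) :=
  inferInstanceAs (CommRing Γ(X, V))

/-- The map `k[t] → Γ(V, 𝒪_X)` induced by `π`. -/
def polyToSec (V : X.Opens) (hV : V ≤ finitePart π) : Polynomial k →+* Γ(X, V) :=
  (π.appLE (affineLine k) V hV).hom.comp (polyToSections k)

instance (V : X.Opens) (hV : V ≤ finitePart π) : Algebra (Polynomial k) (Sec π V hV) :=
  (polyToSec π V hV).toAlgebra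

lemma res_polyToSec {V W : X.Opens} (hV : V ≤ finitePart π) (h : W ≤ V) (a : Polynomial k) :
    X.presheaf.map (homOfLE h).op (polyToSec π V hV a) = polyToSec π W (h.trans hV) a := by
  simp only [polyToSec, RingHom.comp_apply]
  rw [← Scheme.Hom.appLE_map π hV (homOfLE h).op]
  rfl

/-- Restriction of functions. -/
def Sec.res {V W : X.Opens} (hV : V ≤ finitePart π) (hW : W ≤ finitePart π) (h : W ≤ V) :
    Sec π V hV →ₐ[Polynomial k] Sec π W hW :=
  { (X.presheaf.map (homOfLE h).op).hom with
    commutes' := fun a => res_polyToSec π hV h a }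

lemma exists_mem_basicOpen [Surjective π] {a : Polynomial k} (ha : a ≠ 0) :
    ∃ x : X, x ∈ X.basicOpen (polyToSec π (finitePart π) le_rfl a) := by
  have h := basicOpen_polyToSections_ne_bot k ha
  rw [Ne, ← Opens.coe_eq_empty, ← Ne, ← Set.nonempty_iff_ne_empty] at h
  obtain ⟨y, hy⟩ := h
  obtain ⟨x, rfl⟩ := π.surjective y
  have e : polyToSec π (finitePart π) le_rfl a = π.app (affineLine k) (polyToSections k a) := by
    simp only [polyToSec, finitePart, Scheme.Hom.appLE_eq_app]
    rfl
  refine ⟨x, ?_⟩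
  rw [e]
  exact (Scheme.preimage_basicOpen π (polyToSections k a)).le hy

variable [AlgebraicGeometry.IsIntegral X]

lemma genericPoint_mem {U : X.Opens} {z : X} (hz : z ∈ U) : genericPoint X ∈ U :=
  ((genericPoint_spec X).mem_open_set_iff U.isOpen).mpr ⟨z, trivial, hz⟩

lemma genericPoint_mem_finitePart [Surjective π] : genericPoint X ∈ finitePart π := by
  obtain ⟨x, hx⟩ := exists_mem_basicOpen π (one_ne_zero : (1 : Polynomial k) ≠ 0)
  exact genericPoint_mem (X.basicOpen_le _ hx)

/-- The function field `K` of `X`, to be viewed as a `k[t]`-algebra through `π` and as a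
topological field through the local ring at `z`. -/
@[nolint unusedArguments]
def FieldAt (_π : X ⟶ ProjSpace 1 k) (_z : X) : Type u := X.functionField

variable (z : X)

instance : Field (FieldAt π z) := inferInstanceAs (Field X.functionField)

/-- The `z`-adic topology on `K`, with the nonzero fractional ideals of `𝒪_{X,z}` as a basis of
neighbourhoods of zero. -/
instance : TopologicalSpace (FieldAt π z) :=
  (fracBasis (X.presheaf.stalk z) X.functionField).topology

instance : IsTopologicalRing (FieldAt π z) :=
  (fracBasis (X.presheaf.stalk z) X.functionField).toRingFilterBasis.isTopologicalRing

instance : UniformSpace (FieldAt π z) := IsTopologicalAddGroup.rightUniformSpace (FieldAt π z)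

instance : IsUniformAddGroup (FieldAt π z) := isUniformAddGroup_of_addCommGroup

/-- The completion `K_z` of `K` at `z`. -/
def Completed : Type u := UniformSpace.Completion (FieldAt π z)

instance : CommRing (Completed π z) :=
  inferInstanceAs (CommRing (UniformSpace.Completion (FieldAt π z)))

instance : UniformSpace (Completed π z) :=
  inferInstanceAs (UniformSpace (UniformSpace.Completion (FieldAt π z)))

instance : IsTopologicalRing (Completed π z) :=
  inferInstanceAs (IsTopologicalRing (UniformSpace.Completion (FieldAt π z)))

instance : T2Space (Completed π z) :=
  inferInstanceAs (T2Space (UniformSpace.Completion (FieldAt π z)))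

/-- The canonical map `K → K_z`. -/
def toCompleted : FieldAt π z →+* Completed π z := UniformSpace.Completion.coeRingHom

variable [Surjective π]

/-- The map `k[t] → K` induced by `π`. -/
def polyToField : Polynomial k →+* X.functionField :=
  (X.presheaf.germ (finitePart π) (genericPoint X) (genericPoint_mem_finitePart π)).hom.comp
    (polyToSec π (finitePart π) le_rfl)

instance : Algebra (Polynomial k) (FieldAt π z) := (polyToField π).toAlgebra

instance : Algebra (Polynomial k) (Completed π z) :=
  ((toCompleted π z).comp (algebraMap (Polynomial k) (FieldAt π z))).toAlgebra

lemma polyToField_injective : Function.Injective (polyToField π) := by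
  rw [injective_iff_map_eq_zero]
  intro a h
  by_contra ha
  obtain ⟨x, hx⟩ := exists_mem_basicOpen π ha
  have h0 : polyToSec π (finitePart π) le_rfl a = 0 := by
    apply germ_injective_of_isIntegral (X := X) (genericPoint X) (genericPoint_mem_finitePart π)
    rw [map_zero]
    exact h
  rw [h0, Scheme.basicOpen_zero] at hx
  exact hx

/-- The germ map from functions on a nonempty open `V ⊆ Y` to `K_z`. -/
def Sec.toCompleted {V : X.Opens} (hV : V ≤ finitePart π) (hg : genericPoint X ∈ V) :
    Sec π V hV →ₐ[Polynomial k] Completed π z :=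
  { (Carlitz.toCompleted π z).comp (X.presheaf.germ V (genericPoint X) hg).hom with
    commutes' := fun a => by
      change Carlitz.toCompleted π z (X.presheaf.germ V (genericPoint X) hg (polyToSec π V hV a)) =
        Carlitz.toCompleted π z (X.presheaf.germ (finitePart π) (genericPoint X)
          (genericPoint_mem_finitePart π) (polyToSec π (finitePart π) le_rfl a))
      rw [← res_polyToSec π le_rfl hV]
      congr 1
      exact X.presheaf.germ_res_apply (homOfLE hV) (genericPoint X) hg _ }

lemma Sec.toCompleted_res {V W : X.Opens} (hV : V ≤ finitePart π) (hW : W ≤ finitePart π)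
    (h : W ≤ V) (hg : genericPoint X ∈ W) (c : Sec π V hV) :
    Sec.toCompleted π z hW hg (Sec.res π hV hW h c) = Sec.toCompleted π z hV (h hg) c :=
  congrArg (Carlitz.toCompleted π z)
    (X.presheaf.germ_res_apply (homOfLE h) (genericPoint X) hg _)

/-! ### The Carlitz exponential -/

variable [Fintype k]

/-- The terms `eᵢ γ ^ (q ^ i)` of the Carlitz exponential series at `γ ∈ K_z`. -/
def expTerm (γ : Completed π z) (i : ℕ) : Completed π z :=
  toCompleted π z (expCoeff k (FieldAt π z) i) * γ ^ Fintype.card k ^ i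

/-- The relation `exp γ = c`: the Carlitz exponential series converges at `γ`, with sum `c`. -/
def IsExp (γ : Completed π z) (c : C0 k (Completed π z)) : Prop :=
  HasSum (expTerm π z γ) ((toC0 k (Completed π z)).symm c)

/-- The value of the Carlitz exponential at `γ`. -/
def exp (γ : Completed π z) : C0 k (Completed π z) :=
  toC0 k (Completed π z) (∑' i, expTerm π z γ i)

lemma add_pow_card (a b : Completed π z) (i : ℕ) :
    (a + b) ^ Fintype.card k ^ i = a ^ Fintype.card k ^ i + b ^ Fintype.card k ^ i := by
  induction i with
  | zero => simp
  | succ i h =>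
    simp only [pow_succ, pow_mul, h]
    exact map_add (frob k (Completed π z)) _ _

lemma C_pow_card (R : Type u) [CommRing R] [Algebra (Polynomial k) R] (a : k) (i : ℕ) :
    algebraMap (Polynomial k) R (Polynomial.C a) ^ Fintype.card k ^ i =
      algebraMap (Polynomial k) R (Polynomial.C a) := by
  rw [← map_pow, ← map_pow, FiniteField.pow_card_pow]

lemma expCoeff_succ (i : ℕ) : expCoeff k (FieldAt π z) (i + 1) *
      algebraMap (Polynomial k) (FieldAt π z) Polynomial.X ^ Fintype.card k ^ (i + 1) =
    algebraMap (Polynomial k) (FieldAt π z) Polynomial.X * expCoeff k (FieldAt π z) (i + 1) +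
      expCoeff k (FieldAt π z) i ^ Fintype.card k := by
  have hne : algebraMap (Polynomial k) (FieldAt π z) Polynomial.X ^ Fintype.card k ^ (i + 1) -
      algebraMap (Polynomial k) (FieldAt π z) Polynomial.X ≠ 0 := by
    rw [← map_pow, ← map_sub]
    intro h
    have h' := polyToField_injective π (h.trans (map_zero (polyToField π)).symm)
    exact FiniteField.X_pow_card_pow_sub_X_ne_zero k (Nat.succ_ne_zero i)
      Fintype.one_lt_card h'
  rw [expCoeff]
  field_simp
  ring

variable {π z}

lemma IsExp.zero : IsExp π z 0 0 := by
  have : expTerm π z 0 = 0 := by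
    funext i
    simp [expTerm, Fintype.card_ne_zero]
  simp only [IsExp, this, map_zero]
  exact hasSum_zero

lemma IsExp.add {γ γ' : Completed π z} {c c' : C0 k (Completed π z)} (h : IsExp π z γ c)
    (h' : IsExp π z γ' c') : IsExp π z (γ + γ') (c + c') := by
  have : expTerm π z (γ + γ') = fun i => expTerm π z γ i + expTerm π z γ' i := by
    funext i
    simp [expTerm, add_pow_card, mul_add]
  simp only [IsExp, this, map_add]
  exact HasSum.add h h'

lemma IsExp.C_smul {γ : Completed π z} {c : C0 k (Completed π z)} (h : IsExp π z γ c) (a : k) :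
    IsExp π z (Polynomial.C a • γ) (Polynomial.C a • c) := by
  obtain ⟨c, rfl⟩ := (toC0 k _).surjective c
  have : expTerm π z (Polynomial.C a • γ) = fun i =>
      algebraMap (Polynomial k) (Completed π z) (Polynomial.C a) * expTerm π z γ i := by
    funext i
    simp only [expTerm, Algebra.smul_def, mul_pow, C_pow_card]
    ring
  rw [IsExp, this, C_smul_toC0, AddEquiv.symm_apply_apply]
  rw [IsExp, AddEquiv.symm_apply_apply] at h
  exact h.mul_left _

lemma IsExp.X_smul {γ : Completed π z} {c : C0 k (Completed π z)} (h : IsExp π z γ c) :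
    IsExp π z ((Polynomial.X : Polynomial k) • γ) ((Polynomial.X : Polynomial k) • c) := by
  obtain ⟨c, rfl⟩ := (toC0 k _).surjective c
  rw [IsExp, AddEquiv.symm_apply_apply] at h
  rw [IsExp, X_smul_toC0, AddEquiv.symm_apply_apply]
  set t := algebraMap (Polynomial k) (Completed π z) Polynomial.X with ht
  have h1 : HasSum (fun i => t * expTerm π z γ i) (t * c) := h.mul_left _
  have h2 : HasSum (fun i => expTerm π z γ i ^ Fintype.card k) (c ^ Fintype.card k) :=
    HasSum.map h (frob k (Completed π z)) (by
      change Continuous fun x : Completed π z => x ^ Fintype.card k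
      fun_prop)
  let g : ℕ → Completed π z := fun i => Nat.casesOn i 0 fun j => expTerm π z γ j ^ Fintype.card k
  have h3 : HasSum g (c ^ Fintype.card k) := by
    have : HasSum (fun i => g (i + 1)) (c ^ Fintype.card k) := h2
    simpa [g] using this.zero_add
  have : expTerm π z ((Polynomial.X : Polynomial k) • γ) =
      fun i => t * expTerm π z γ i + g i := by
    funext i
    rcases i with _ | i
    · simp [expTerm, g, Algebra.smul_def, expCoeff, ht]
    · have e := congrArg (toCompleted π z) (expCoeff_succ π z i)
      simp only [map_add, map_mul, map_pow] at e
      change _ * t ^ _ = t * _ + _ at e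
      simp only [expTerm, g, Algebra.smul_def, mul_pow, ← ht]
      rw [← mul_assoc, e, add_mul, ← pow_mul, ← pow_succ]
      ring
  rw [this]
  exact h1.add h3

lemma IsExp.smul {γ : Completed π z} {c : C0 k (Completed π z)} (h : IsExp π z γ c)
    (a : Polynomial k) : IsExp π z (a • γ) (a • c) := by
  induction a using Polynomial.induction_on generalizing γ c with
  | C a => exact h.C_smul a
  | add p r hp hr =>
    rw [add_smul, add_smul]
    exact (hp h).add (hr h)
  | monomial n a hn =>
    have e : (Polynomial.C a * Polynomial.X ^ (n + 1) : Polynomial k) =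
      (Polynomial.C a * Polynomial.X ^ n) * Polynomial.X := by ring
    have hX := h.X_smul
    have h2 := hn hX
    rw [← mul_smul, ← mul_smul, ← e] at h2
    exact h2

variable (π)

/-! ### The sheaf `C` -/

/-- The points of an open `U` that lie above `∞`. -/
abbrev InftyIn (U : X.Opens) : Type u := {z : AtInfty π // z.1 ∈ U}

/-- The module `C₀(U ∩ Y) × ∏_{z ∈ U \ Y} K_z`. -/
abbrev Pairs (U : X.Opens) : Type u :=
  C0 k (Sec π (U ⊓ finitePart π) inf_le_right) × ∀ z : InftyIn π U, Completed π z.1.1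

/-- The image in `C₀(K_z)` of an element of `C₀(U ∩ Y)`, for a point `z` of `U`. -/
def localize {U : X.Opens} (z : InftyIn π U) :
    C0 k (Sec π (U ⊓ finitePart π) inf_le_right) →ₗ[Polynomial k] C0 k (Completed π z.1.1) :=
  C0.map k (Sec.toCompleted π z.1.1 inf_le_right
    ⟨genericPoint_mem z.2, genericPoint_mem_finitePart π⟩)

/-- The module `C(U)` of pairs `(c, (γ_z)_z)` with `exp γ_z = c` for all `z`. -/
def carlitzSections (U : X.Opens) : Submodule (Polynomial k) (Pairs π U) where
  carrier := {s | ∀ z : InftyIn π U, IsExp π z.1.1 (s.2 z) (localize π z s.1)}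
  zero_mem' z := by
    simpa using IsExp.zero
  add_mem' {s s'} h h' z := by
    simpa using (h z).add (h' z)
  smul_mem' a s h z := by
    simpa using (h z).smul a

/-- Restriction `C₀(U ∩ Y) × ∏_{z ∈ U \ Y} K_z → C₀(V ∩ Y) × ∏_{z ∈ V \ Y} K_z`. -/
def Pairs.res {U V : X.Opens} (h : V ≤ U) : Pairs π U →ₗ[Polynomial k] Pairs π V where
  toFun s := (C0.map k (Sec.res π inf_le_right inf_le_right (inf_le_inf_right _ h)) s.1,
    fun z => s.2 ⟨z.1, h z.2⟩)
  map_add' s s' := by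
    ext <;> simp
  map_smul' a s := by
    ext <;> simp

lemma localize_res {U V : X.Opens} (h : V ≤ U) (s : Pairs π U) (z : InftyIn π V) :
    localize π z (Pairs.res π h s).1 = localize π (U := U) ⟨z.1, h z.2⟩ s.1 :=
  Sec.toCompleted_res π z.1.1 inf_le_right inf_le_right (inf_le_inf_right _ h) _ _

/-- The presheaf `U ↦ C(U)` of `k[t]`-modules. -/
def carlitzPresheaf : TopCat.Presheaf (ModuleCat.{u} (Polynomial k)) X where
  obj U := ModuleCat.of (Polynomial k) (carlitzSections π U.unop)
  map {U V} f := ModuleCat.ofHom ((Pairs.res π f.unop.le).restrict (fun s hs z => by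
    rw [localize_res]
    exact hs ⟨z.1, f.unop.le z.2⟩))
  map_id U := by
    refine ModuleCat.hom_ext (LinearMap.ext fun s => Subtype.ext (Prod.ext ?_ rfl))
    exact ConcreteCategory.congr_hom (X.presheaf.map_id _) s.1.1
  map_comp {U V W} f g := by
    refine ModuleCat.hom_ext (LinearMap.ext fun s => Subtype.ext (Prod.ext ?_ rfl))
    exact ConcreteCategory.congr_hom (X.presheaf.map_comp
      (homOfLE (inf_le_inf_right (finitePart π) f.unop.le)).op
      (homOfLE (inf_le_inf_right (finitePart π) g.unop.le)).op) s.1.1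

lemma carlitzPresheaf_isSheaf : (carlitzPresheaf (k := k) π).IsSheaf := by
  rw [TopCat.Presheaf.isSheaf_iff_isSheafUniqueGluing]
  intro ι U sf hsf
  let s : ∀ i, Pairs π (U i) := fun i => (sf i).1
  have hs : ∀ i, s i ∈ carlitzSections π (U i) := fun i => (sf i).2
  have hc : ∀ i j, Pairs.res π (inf_le_left : U i ⊓ U j ≤ U i) (s i) =
      Pairs.res π (inf_le_right : U i ⊓ U j ≤ U j) (s j) := fun i j =>
    congrArg Subtype.val (hsf i j)
  let V : ι → X.Opens := fun i => U i ⊓ finitePart π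
  have hle : ∀ i, V i ≤ iSup U ⊓ finitePart π := fun i => inf_le_inf_right _ (le_iSup U i)
  have hcov : iSup U ⊓ finitePart π ≤ iSup V := by rw [iSup_inf_eq]
  let c : ∀ i, Γ(X, V i) := fun i => (s i).1
  have hcc : ∀ i j, X.presheaf.map (homOfLE (inf_le_left : V i ⊓ V j ≤ V i)).op (c i) =
      X.presheaf.map (homOfLE (inf_le_right : V i ⊓ V j ≤ V j)).op (c j) := by
    intro i j
    have h1 : X.presheaf.map (homOfLE (inf_le_inf_right (finitePart π)
          (inf_le_left : U i ⊓ U j ≤ U i))).op (c i) =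
        X.presheaf.map (homOfLE (inf_le_inf_right (finitePart π)
          (inf_le_right : U i ⊓ U j ≤ U j))).op (c j) := congrArg Prod.fst (hc i j)
    have hW : V i ⊓ V j ≤ (U i ⊓ U j) ⊓ finitePart π :=
      le_inf (inf_le_inf inf_le_left inf_le_left) (inf_le_left.trans inf_le_right)
    have h2 := congrArg (X.presheaf.map (homOfLE hW).op) h1
    rw [← ConcreteCategory.comp_apply, ← ConcreteCategory.comp_apply, ← Functor.map_comp,
      ← Functor.map_comp] at h2
    exact h2
  obtain ⟨c₀, hc₀, huniq⟩ := X.sheaf.existsUnique_gluing' V (iSup U ⊓ finitePart π)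
    (fun i => homOfLE (hle i)) hcov c hcc
  have hex : ∀ z : InftyIn π (iSup U), ∃ i, z.1.1 ∈ U i := fun z => Opens.mem_iSup.mp z.2
  choose idx hidx using hex
  let γ : ∀ z : InftyIn π (iSup U), Completed π z.1.1 := fun z => (s (idx z)).2 ⟨z.1, hidx z⟩
  have hγ : ∀ (z : InftyIn π (iSup U)) (i : ι) (hz : z.1.1 ∈ U i),
      γ z = (s i).2 ⟨z.1, hz⟩ := fun z i hz =>
    congrFun (congrArg Prod.snd (hc (idx z) i)) ⟨z.1, hidx z, hz⟩
  let σ : Pairs π (iSup U) := (c₀, γ)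
  have hres : ∀ i, Pairs.res π (le_iSup U i) σ = s i := by
    intro i
    refine Prod.ext (hc₀ i) (funext fun z => ?_)
    exact hγ ⟨z.1, le_iSup U i z.2⟩ i z.2
  have hσ : σ ∈ carlitzSections π (iSup U) := by
    intro z
    have h := hs (idx z) ⟨z.1, hidx z⟩
    rw [← hres (idx z), localize_res] at h
    exact h
  refine ⟨⟨σ, hσ⟩, fun i => Subtype.ext (hres i), ?_⟩
  rintro ⟨τ, hτ⟩ h
  have hτ' : ∀ i, Pairs.res π (le_iSup U i) τ = s i := fun i => congrArg Subtype.val (h i)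
  refine Subtype.ext (Prod.ext (huniq τ.1 fun i => congrArg Prod.fst (hτ' i)) (funext fun z => ?_))
  exact congrFun (congrArg Prod.snd (hτ' (idx z))) ⟨z.1, hidx z⟩

/-- The sheaf `C` of `k[t]`-modules on `X`. -/
def carlitzSheaf : Sheaf (Opens.grothendieckTopology X) (ModuleCat.{u} (Polynomial k)) :=
  ⟨carlitzPresheaf π, carlitzPresheaf_isSheaf π⟩

/-- `C₀(Y)`. -/
abbrev C0Y : Type u := C0 k (Sec π (finitePart π) le_rfl)

/-- The inclusion `C(X) → C₀(Y) × ∏_{z ∈ X \ Y} K_z`. -/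
def globalInclusion : (carlitzSheaf (k := k) π).obj.obj (op ⊤) →ₗ[Polynomial k]
    C0Y (k := k) π × ∀ z : AtInfty π, Completed π z.1 where
  toFun s := (C0.map k (Sec.res π inf_le_right le_rfl (le_inf le_top le_rfl)) s.1.1,
    fun z => s.1.2 ⟨z, trivial⟩)
  map_add' s s' := by
    refine Prod.ext ?_ rfl
    exact map_add _ s.1.1 s'.1.1
  map_smul' a s := by
    refine Prod.ext ?_ rfl
    exact map_smul _ a s.1.1

/-- The natural map `C₀(Y) → C₀(K_z)`. -/
def localizeY (z : X) : C0Y (k := k) π →ₗ[Polynomial k] C0 k (Completed π z) :=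
  C0.map k (Sec.toCompleted π z le_rfl (genericPoint_mem_finitePart π))

end Curve

/-! ### Sheaf cohomology -/

/-- The cohomology `Hⁿ(T, F)` of a sheaf `F` of `A`-modules on a topological space `T`, with its
`A`-module structure, as the `n`-th derived functor of `Γ(T, -) = Hom(A_T, -)`, where `A_T` is the
constant sheaf. -/
abbrev cohomology {A : Type u} [CommRing A] {T : TopCat.{u}}
    (F : Sheaf (Opens.grothendieckTopology T) (ModuleCat.{u} A)) (n : ℕ) : Type u :=
  Abelian.Ext ((constantSheaf (Opens.grothendieckTopology T) (ModuleCat.{u} A)).obj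
    (ModuleCat.of A A)) F n

end Carlitz

end

/-! Write `𝒫` for the sheaf `U ↦ C₀(U ∩ Y) × ∏_{z ∈ U \ Y} K_z` and `𝒬` for the sheaf
`U ↦ ∏_{z ∈ U \ Y} C₀(K_z)`. By definition `C` is the kernel of `δ : 𝒫 → 𝒬`,
`(c, γ) ↦ (c - exp γ_z)_z`, and the exact sequence is the beginning of the long exact cohomology
sequence of `0 → C → 𝒫 → 𝒬 → 0`, provided that `δ` is an epimorphism of sheaves and
`H¹(X, 𝒫) = 0`.

Let `z` be a point over infinity. Then `s = 1 / t` lies in the maximal ideal of `𝒪_z`, and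
inverting it turns `𝒪_z` into `K`. The recursion for the coefficients shows that `e_i` is a
multiple of `s ^ (i q ^ i)`. Therefore `exp` converges on all of `K_z`, and on the closure of `𝒪_z`
it is the identity plus a contraction, so that its image contains this neighbourhood of `0`. As `K`
is dense, `K_z = K + exp K_z`. Every element of `K` is regular on a punctured neighbourhood of `z`,
hence `δ` is locally surjective.

The components in `∏ K_z` of a Čech 1-cocycle of `𝒫` split tautologically. The components in `C₀`
are rational functions, and since poles at infinity are allowed, splitting them is the first
Cousin problem on `Y`, which is affine because `π` is finite. -/

noncomputable section

attribute [local instance] MvPolynomial.gradedAlgebra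

/-- Sheaves of `A`-modules on a topological space, in the encoding used by
`Carlitz.cohomology`. -/
abbrev ModuleSheaf (A : Type u) [CommRing A] (T : TopCat.{u}) :=
  Sheaf (Opens.grothendieckTopology T) (ModuleCat.{u} A)

namespace ModuleSheaf

variable {A : Type u} [CommRing A] {T : TopCat.{u}}

section Sections

/-- Restriction of sections as a linear map. -/
def res (F : ModuleSheaf A T) {U V : Opens T} (h : V ≤ U) :
    F.obj.obj (op U) →ₗ[A] F.obj.obj (op V) :=
  (F.obj.map (homOfLE h).op).hom

lemma res_res (F : ModuleSheaf A T) {U V W : Opens T} (h : V ≤ U) (h' : W ≤ V)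
    (s : F.obj.obj (op U)) : res F h' (res F h s) = res F (h'.trans h) s :=
  (ConcreteCategory.congr_hom (F.obj.map_comp (homOfLE h).op (homOfLE h').op) s).symm

lemma app_res {F G : ModuleSheaf A T} (f : F ⟶ G) {U V : Opens T} (h : V ≤ U)
    (s : F.obj.obj (op U)) : f.hom.app (op V) (res F h s) = res G h (f.hom.app (op U) s) :=
  ConcreteCategory.congr_hom (f.hom.naturality (homOfLE h).op) s

lemma exists_res_eq_of_cover (F : ModuleSheaf A T) {ι : Type*} {V : ι → Opens T}
    (hV : ⊤ ≤ iSup V) (t : ∀ i, F.obj.obj (op (V i)))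
    (ht : ∀ i j, res F (inf_le_left : V i ⊓ V j ≤ V i) (t i) = res F inf_le_right (t j)) :
    ∃ r : F.obj.obj (op ⊤), ∀ i, res F le_top r = t i :=
  (TopCat.Sheaf.existsUnique_gluing' F V ⊤ (fun _ => homOfLE le_top) hV t ht).exists

lemma eq_of_res_eq_of_cover (F : ModuleSheaf A T) {ι : Type*} {V : ι → Opens T}
    (hV : ⊤ ≤ iSup V) {r r' : F.obj.obj (op ⊤)}
    (h : ∀ i, res F (le_top : V i ≤ ⊤) r = res F le_top r') : r = r' :=
  TopCat.Sheaf.eq_of_locally_eq' F V ⊤ (fun _ => homOfLE le_top) hV r r' h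

lemma app_injective {F G : ModuleSheaf A T} (f : F ⟶ G) [Mono f] (U : Opens T) :
    Function.Injective (f.hom.app (op U)) := by
  have h : Mono ((sheafToPresheaf _ _).map f) := inferInstance
  rw [NatTrans.mono_iff_mono_app] at h
  exact (ModuleCat.mono_iff_injective _).mp (h (op U))

lemma app_comp_app_eq_zero (S : ShortComplex (ModuleSheaf A T)) {U : Opens T}
    (s : S.X₁.obj.obj (op U)) : S.g.hom.app (op U) (S.f.hom.app (op U) s) = 0 :=
  congrArg (fun φ : S.X₁ ⟶ S.X₃ => φ.hom.app (op U) s) S.zero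

lemma exists_app_eq_of_exact {S : ShortComplex (ModuleSheaf A T)} (hS : S.Exact) [Mono S.f]
    {U : Opens T} (s : S.X₂.obj.obj (op U)) (hs : S.g.hom.app (op U) s = 0) :
    ∃ t : S.X₁.obj.obj (op U), S.f.hom.app (op U) t = s := by
  let F := sheafToPresheaf (Opens.grothendieckTopology T) (ModuleCat.{u} A) ⋙
    (evaluation (Opens T)ᵒᵖ (ModuleCat.{u} A)).obj (op U)
  have h : (S.map F).Exact :=
    ((F.preservesFiniteLimits_tfae.out 1 3 rfl rfl).mpr inferInstance S ⟨hS, inferInstance⟩).1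
  exact (ShortComplex.moduleCat_exact_iff _).mp h s hs

lemma exists_local_lift {F G : ModuleSheaf A T} (f : F ⟶ G) [Epi f] {U : Opens T}
    (s : G.obj.obj (op U)) {x : T} (hx : x ∈ U) :
    ∃ (V : Opens T) (h : V ≤ U) (t : F.obj.obj (op V)), x ∈ V ∧
      f.hom.app (op V) t = res G h s := by
  have h := (TopCat.Sheaf.isLocallySurjective_iff_epi f).mpr ‹Epi f›
  obtain ⟨V, hV, ⟨t, ht⟩, hx⟩ := (TopCat.Presheaf.isLocallySurjective_iff f.hom).mp h U s x hx
  exact ⟨V, hV, t, hx, ht⟩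

end Sections

section Cech

/-- The Čech 1-cocycles of `F` for the family `U`. The relation is imposed on every open set
contained in `U i`, `U j` and `U k`, so that no triple intersection has to be written down. -/
def IsCocycle (F : ModuleSheaf A T) {ι : Type*} (U : ι → Opens T)
    (f : ∀ i j, F.obj.obj (op (U i ⊓ U j))) : Prop :=
  ∀ (i j k : ι) (W : Opens T) (hi : W ≤ U i) (hj : W ≤ U j) (hk : W ≤ U k),
    res F (le_inf hi hj) (f i j) + res F (le_inf hj hk) (f j k) = res F (le_inf hi hk) (f i k)

/-- Vanishing of the first Čech cohomology of `F`: every 1-cocycle becomes a coboundary after a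
refinement of the covering. Coverings are indexed by the points of `T`, which are enough up to
refinement. -/
def CechAcyclic (F : ModuleSheaf A T) : Prop :=
  ∀ (U : T → Opens T), (∀ x, x ∈ U x) → ∀ f, IsCocycle F U f →
    ∃ (V : T → Opens T) (hVU : ∀ x, V x ≤ U x) (g : ∀ x, F.obj.obj (op (V x))),
      (∀ x, x ∈ V x) ∧ ∀ x y, res F (inf_le_inf (hVU x) (hVU y)) (f x y) =
        res F inf_le_left (g x) - res F inf_le_right (g y)

variable {S : ShortComplex (ModuleSheaf A T)}

lemma exists_isCocycle_of_lifts (hS : S.Exact) [Mono S.f] {s : S.X₃.obj.obj (op ⊤)} {ι : Type*}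
    {U : ι → Opens T} (t : ∀ i, S.X₂.obj.obj (op (U i)))
    (ht : ∀ i, S.g.hom.app (op (U i)) (t i) = res S.X₃ le_top s) :
    ∃ f, IsCocycle S.X₁ U f ∧ ∀ i j, S.f.hom.app (op (U i ⊓ U j)) (f i j) =
      res S.X₂ inf_le_left (t i) - res S.X₂ inf_le_right (t j) := by
  have hdiff (i j) : ∃ f, S.f.hom.app (op (U i ⊓ U j)) f =
      res S.X₂ inf_le_left (t i) - res S.X₂ inf_le_right (t j) := by
    apply exists_app_eq_of_exact hS
    rw [map_sub, app_res, app_res, ht, ht, res_res, res_res, sub_self]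
  choose f hf using hdiff
  refine ⟨f, fun i j k W hi hj hk => app_injective S.f W ?_, hf⟩
  simp only [map_add, app_res, hf, map_sub, res_res, sub_add_sub_cancel]

/-- Lifts of a section of `S.X₃` over a covering differ by a cocycle of `S.X₁`; correcting them by
a cochain that bounds this cocycle makes them agree on overlaps. -/
lemma CechAcyclic.app_surjective (hS : S.ShortExact) (h : CechAcyclic S.X₁) :
    Function.Surjective (S.g.hom.app (op ⊤)) := by
  have := hS.mono_f
  have := hS.epi_g
  intro s
  choose U hU t hx ht using fun x : T => exists_local_lift S.g s (x := x) trivial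
  obtain ⟨f, hcocycle, hf⟩ := exists_isCocycle_of_lifts hS.exact t ht
  obtain ⟨V, hVU, g, hV, hg⟩ := h U hx f hcocycle
  have hcov : (⊤ : Opens T) ≤ iSup V := fun x _ => Opens.mem_iSup.mpr ⟨x, hV x⟩
  let t' (x : T) : S.X₂.obj.obj (op (V x)) := res S.X₂ (hVU x) (t x) - S.f.hom.app (op (V x)) (g x)
  have ht' (x : T) : S.g.hom.app (op (V x)) (t' x) = res S.X₃ le_top s := by
    simp only [t', map_sub, app_comp_app_eq_zero, app_res, ht, res_res, sub_zero]
  have hagree (x y : T) : res S.X₂ (inf_le_left : V x ⊓ V y ≤ V x) (t' x) =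
      res S.X₂ inf_le_right (t' y) := by
    have e := congrArg (S.f.hom.app (op (V x ⊓ V y))) (hg x y)
    simp only [app_res, hf, map_sub, res_res] at e
    simpa only [t', map_sub, res_res, app_res] using sub_eq_sub_iff_sub_eq_sub.mpr e
  obtain ⟨r, hr⟩ := exists_res_eq_of_cover S.X₂ hcov t' hagree
  refine ⟨r, eq_of_res_eq_of_cover S.X₃ hcov fun x => ?_⟩
  rw [← app_res, hr, ht']

end Cech

section Cohomology

/-- The adjunction between constant sheaves and global sections. -/
abbrev constantAdj (A : Type u) [CommRing A] (T : TopCat.{u}) :=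
  constantSheafAdj (Opens.grothendieckTopology T) (ModuleCat.{u} A)
    (Preorder.isTerminalTop (Opens T))

/-- The identification `Hom(A_T, F) = Γ(T, F)`, where `A_T` is the constant sheaf. -/
def homEquivSections (F : ModuleSheaf A T) :
    ((constantSheaf (Opens.grothendieckTopology T) (ModuleCat.{u} A)).obj
      (ModuleCat.of A A) ⟶ F) ≃ₗ[A] F.obj.obj (op ⊤) where
  __ := (((constantAdj A T).homEquiv (ModuleCat.of A A) F).trans ModuleCat.homEquiv).trans
    (LinearMap.ringLmapEquivSelf A A (F.obj.obj (op ⊤))).toEquiv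
  map_add' _ _ := by
    simp only [Functor.flip_obj_obj, ObjectProperty.ι_obj, Equiv.toFun_as_coe, Equiv.trans_apply,
      Adjunction.homEquiv_unit, Functor.comp_obj, Functor.flip_obj_map, ObjectProperty.ι_map,
      Sheaf.Hom.add_app, Preadditive.comp_add, LinearEquiv.coe_toEquiv,
      LinearMap.ringLmapEquivSelf_apply]
    rfl
  map_smul' _ _ := by
    simp only [Functor.flip_obj_obj, ObjectProperty.ι_obj, Equiv.toFun_as_coe, Equiv.trans_apply,
      Adjunction.homEquiv_unit, Functor.comp_obj, Functor.flip_obj_map, ObjectProperty.ι_map,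
      LinearEquiv.coe_toEquiv, LinearMap.ringLmapEquivSelf_apply, RingHom.id_apply]
    rfl

lemma homEquivSections_comp {F G : ModuleSheaf A T}
    (f : (constantSheaf (Opens.grothendieckTopology T) (ModuleCat.{u} A)).obj
      (ModuleCat.of A A) ⟶ F) (g : F ⟶ G) :
    homEquivSections G (f ≫ g) = g.hom.app (op ⊤) (homEquivSections F f) := by
  change ((constantAdj A T).homEquiv (ModuleCat.of A A) _ (f ≫ g)).hom (1 : A) = _
  rw [Adjunction.homEquiv_naturality_right]
  rfl

/-- The identification `Γ(T, F) = H⁰(T, F)`. -/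
def sectionsEquiv (F : ModuleSheaf A T) : F.obj.obj (op ⊤) ≃ₗ[A] Carlitz.cohomology F 0 :=
  (homEquivSections F).symm ≪≫ₗ (Abelian.Ext.linearEquiv₀ (R := A)).symm

lemma sectionsEquiv_app {F G : ModuleSheaf A T} (g : F ⟶ G) (s : F.obj.obj (op ⊤)) :
    sectionsEquiv G (g.hom.app (op ⊤) s) =
      (sectionsEquiv F s).comp (Abelian.Ext.mk₀ g) (add_zero 0) := by
  obtain ⟨f, rfl⟩ := (homEquivSections F).surjective s
  rw [← homEquivSections_comp]
  simp [sectionsEquiv, Abelian.Ext.linearEquiv₀]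

lemma CechAcyclic.subsingleton_cohomology_one {F : ModuleSheaf A T} (h : CechAcyclic F) :
    Subsingleton (Carlitz.cohomology F 1) := by
  let S : ShortComplex (ModuleSheaf A T) := ShortComplex.mk (Injective.ι F)
    (Limits.cokernel.π (Injective.ι F)) (Limits.cokernel.condition _)
  have hS : S.ShortExact :=
    { exact := ShortComplex.exact_of_g_is_cokernel _ (Limits.cokernelIsCokernel _)
      mono_f := inferInstanceAs (Mono (Injective.ι F))
      epi_g := inferInstanceAs (Epi (Limits.cokernel.π _)) }
  have hI : Injective S.X₂ := inferInstanceAs (Injective (Injective.under F))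
  refine subsingleton_of_forall_eq 0 fun x => ?_
  obtain ⟨y, rfl⟩ := Abelian.Ext.covariant_sequence_exact₁ _ hS x
    (Abelian.Ext.eq_zero_of_injective _) (zero_add 1)
  obtain ⟨s, rfl⟩ := (sectionsEquiv S.X₃).surjective y
  obtain ⟨r, rfl⟩ := CechAcyclic.app_surjective hS h s
  rw [sectionsEquiv_app, Abelian.Ext.comp_assoc_of_second_deg_zero, hS.comp_extClass,
    Abelian.Ext.comp_zero]

variable {S : ShortComplex (ModuleSheaf A T)} (hS : S.ShortExact)

/-- The connecting homomorphism `Γ(T, F₃) → H¹(T, F₁)` of a short exact sequence. -/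
def connecting : S.X₃.obj.obj (op ⊤) →ₗ[A] Carlitz.cohomology S.X₁ 1 :=
  hS.extClass.postcompOfLinear A _ (zero_add 1) ∘ₗ (sectionsEquiv S.X₃).toLinearMap

lemma connecting_apply (s : S.X₃.obj.obj (op ⊤)) :
    connecting hS s = (sectionsEquiv S.X₃ s).comp hS.extClass (zero_add 1) := rfl

lemma exact_app_connecting : Function.Exact (S.g.hom.app (op ⊤)) (connecting hS) := by
  intro s
  constructor
  · intro h
    obtain ⟨y, hy⟩ := Abelian.Ext.covariant_sequence_exact₃ _ hS _ (zero_add 1) h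
    obtain ⟨r, rfl⟩ := (sectionsEquiv S.X₂).surjective y
    rw [← sectionsEquiv_app] at hy
    exact ⟨r, (sectionsEquiv S.X₃).injective hy⟩
  · rintro ⟨r, rfl⟩
    rw [connecting_apply, sectionsEquiv_app, Abelian.Ext.comp_assoc_of_second_deg_zero,
      hS.comp_extClass, Abelian.Ext.comp_zero]

lemma connecting_surjective [Subsingleton (Carlitz.cohomology S.X₂ 1)] :
    Function.Surjective (connecting hS) := by
  intro x
  obtain ⟨y, rfl⟩ := Abelian.Ext.covariant_sequence_exact₁ _ hS x (Subsingleton.elim _ _)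
    (zero_add 1)
  obtain ⟨s, rfl⟩ := (sectionsEquiv S.X₃).surjective y
  exact ⟨s, rfl⟩

end Cohomology

end ModuleSheaf

namespace AdicExp

open Filter Topology

section Group

variable {L : Type*} [AddCommGroup L] [UniformSpace L] [IsUniformAddGroup L]
  {U : ℕ → AddSubgroup L} (hU : (𝓝 (0 : L)).HasBasis (fun _ => True) fun n => (U n : Set L))

include hU

lemma isOpen_of_basis (n : ℕ) : IsOpen (U n : Set L) :=
  (U n).isOpen_of_mem_nhds (hU.mem_of_mem trivial)

lemma nonarchimedean_of_basis : NonarchimedeanAddGroup L where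
  is_nonarchimedean V hV := by
    obtain ⟨n, -, hn⟩ := hU.mem_iff.mp hV
    exact ⟨⟨U n, isOpen_of_basis hU n⟩, hn⟩

lemma summable_of_mem [CompleteSpace L] (hanti : Antitone U) {f : ℕ → L} (N : ℕ)
    (hf : ∀ i, f (i + N) ∈ U i) : Summable f := by
  have := nonarchimedean_of_basis hU
  refine NonarchimedeanAddGroup.summable_of_tendsto_cofinite_zero ?_
  rw [Nat.cofinite_eq_atTop, hU.tendsto_right_iff]
  intro n _
  filter_upwards [eventually_ge_atTop (n + N)] with i hi
  obtain ⟨j, rfl⟩ := Nat.exists_eq_add_of_le' (le_of_add_le_right hi)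
  exact hanti (Nat.le_of_add_le_add_right hi) (hf j)

lemma hasSum_mem {f : ℕ → L} {a : L} (h : HasSum f a) {n : ℕ} (hf : ∀ i, f i ∈ U n) :
    a ∈ U n :=
  (AddSubgroup.isClosed_of_isOpen _ (isOpen_of_basis hU n)).mem_of_tendsto h
    (Eventually.of_forall fun _ => (U n).sum_mem fun i _ => hf i)

/-- The solution is the Neumann series `c - h c + h (h c) - ⋯`. -/
lemma exists_add_eq_of_contracting [CompleteSpace L] [T2Space L] (hanti : Antitone U)
    (h : L →+ L) (hh : ∀ n, ∀ x ∈ U n, h x ∈ U (n + 1)) {c : L} (hc : c ∈ U 0) :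
    ∃ x : L, x + h x = c := by
  have hcont : Continuous h := by
    refine continuous_of_continuousAt_zero h ?_
    rw [ContinuousAt, map_zero, hU.tendsto_iff hU]
    exact fun n _ => ⟨n, trivial, fun x hx => hanti n.le_succ (hh n x hx)⟩
  let f (n : ℕ) : L := (fun x => -h x)^[n] c
  have hsucc (n : ℕ) : f (n + 1) = -h (f n) := Function.iterate_succ_apply' _ n c
  have hf (n : ℕ) : f n ∈ U n := by
    induction n with
    | zero => exact hc
    | succ n ih =>
      rw [hsucc]
      exact (U (n + 1)).neg_mem (hh n _ ih)
  obtain ⟨x, hx⟩ := summable_of_mem hU hanti 0 hf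
  have htail : HasSum (fun n => f (n + 1)) (-h x) := by
    simp only [hsucc]
    exact (hx.map h hcont).neg
  have hx0 : c + -h x = x := htail.zero_add.unique hx
  exact ⟨x, add_eq_of_eq_sub (hx0 ▸ sub_eq_add_neg c (h x)).symm⟩

end Group

section Ring

variable {L : Type*} [CommRing L]

/-- The subgroup `s ^ n O` of `L`, a neighbourhood of `0` in the `s`-adic topology. -/
def powNhd (O : Subring L) (s : L) (n : ℕ) : AddSubgroup L :=
  O.toAddSubgroup.map (AddMonoidHom.mulLeft (s ^ n))

variable {O : Subring L} {s : L}

lemma mem_powNhd {n : ℕ} {x : L} : x ∈ powNhd O s n ↔ ∃ y ∈ O, s ^ n * y = x :=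
  AddSubgroup.mem_map

lemma powNhd_antitone (hs : s ∈ O) : Antitone (powNhd O s) := by
  intro m n hmn x hx
  obtain ⟨y, hy, rfl⟩ := mem_powNhd.mp hx
  obtain ⟨d, rfl⟩ := Nat.exists_eq_add_of_le hmn
  exact mem_powNhd.mpr ⟨s ^ d * y, O.mul_mem (O.pow_mem hs d) hy, by ring⟩

variable [UniformSpace L] [IsTopologicalRing L]
  (hU : (𝓝 (0 : L)).HasBasis (fun _ => True) fun n => (powNhd O s n : Set L))

include hU

lemma exists_pow_mul_mem (x : L) : ∃ n, s ^ n * x ∈ O := by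
  have h : Tendsto (fun y => y * x) (𝓝 (0 : L)) (𝓝 0) := by
    simpa only [zero_mul] using (continuous_mul_const x).tendsto (0 : L)
  obtain ⟨n, -, hn⟩ := (hU.tendsto_iff hU).mp h 0 trivial
  obtain ⟨y, hy, h⟩ := mem_powNhd.mp (hn (s ^ n) (mem_powNhd.mpr ⟨1, O.one_mem, mul_one _⟩))
  rw [pow_zero, one_mul] at h
  exact ⟨n, h ▸ hy⟩

variable [IsUniformAddGroup L] [CompleteSpace L] (hs : s ∈ O) {u : ℕ → L} (hu : ∀ i, u i ∈ O)
  {q : ℕ} (hq : 0 < q)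

include hs hu hq

lemma summable_exp (x : L) : Summable fun i => u i * s ^ (i * q ^ i) * x ^ q ^ i := by
  obtain ⟨N, hN⟩ := exists_pow_mul_mem hU x
  refine summable_of_mem hU (powNhd_antitone hs) N fun i => ?_
  have h : i ≤ i * q ^ (i + N) := Nat.le_mul_of_pos_right _ (by positivity)
  refine powNhd_antitone hs h (mem_powNhd.mpr
    ⟨u (i + N) * (s ^ N * x) ^ q ^ (i + N), O.mul_mem (hu _) (O.pow_mem hN _), ?_⟩)
  ring

lemma tsum_exp_succ_mem {n : ℕ} {x : L} (hx : x ∈ powNhd O s n) :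
    ∑' i, u (i + 1) * s ^ ((i + 1) * q ^ (i + 1)) * x ^ q ^ (i + 1) ∈ powNhd O s (n + 1) := by
  refine hasSum_mem hU ((summable_nat_add_iff 1).mpr (summable_exp hU hs hu hq x)).hasSum
    fun i => ?_
  obtain ⟨y, hy, rfl⟩ := mem_powNhd.mp hx
  have h : n + 1 ≤ (i + 1 + n) * q ^ (i + 1) :=
    le_trans (by lia) (Nat.le_mul_of_pos_right _ (by positivity))
  refine powNhd_antitone hs h (mem_powNhd.mpr
    ⟨u (i + 1) * y ^ q ^ (i + 1), O.mul_mem (hu _) (O.pow_mem hy _), ?_⟩)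
  ring

/-- On `O` the exponential is the identity plus a contraction. -/
lemma exists_hasSum_exp [T2Space L] (hu0 : u 0 = 1)
    (hadd : ∀ (x y : L) (i : ℕ), (x + y) ^ q ^ i = x ^ q ^ i + y ^ q ^ i) {c : L} (hc : c ∈ O) :
    ∃ x, HasSum (fun i => u i * s ^ (i * q ^ i) * x ^ q ^ i) c := by
  have hsum (x : L) := (summable_nat_add_iff 1).mpr (summable_exp hU hs hu hq x)
  let tail : L →+ L := AddMonoidHom.mk'
    (fun x => ∑' i, u (i + 1) * s ^ ((i + 1) * q ^ (i + 1)) * x ^ q ^ (i + 1)) fun x y => by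
      rw [← (hsum x).tsum_add (hsum y)]
      simp only [hadd, mul_add]
  obtain ⟨x, rfl⟩ := exists_add_eq_of_contracting hU (powNhd_antitone hs) tail
    (fun n x => tsum_exp_succ_mem hU hs hu hq) (c := c) (mem_powNhd.mpr ⟨c, hc, by simp⟩)
  refine ⟨x, ?_⟩
  have h := (hsum x).hasSum.zero_add (f := fun i => u i * s ^ (i * q ^ i) * x ^ q ^ i)
  rwa [hu0, zero_mul, pow_zero, pow_zero, pow_one, one_mul, one_mul] at h

end Ring

section Completion

variable {R K L : Type u} [CommRing R] [Field K] [Algebra R K] [TopologicalSpace K]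

lemma hasBasis_fracNhd_pow (hK : (𝓝 (0 : K)).HasBasis (fun _ : Kˣ => True)
      fun a => (Carlitz.fracNhd R K a : Set K)) {s : R} (hs : algebraMap R K s ≠ 0)
    (hfrac : ∀ x : K, ∃ (n : ℕ) (r : R), algebraMap R K s ^ n * x = algebraMap R K r) :
    (𝓝 (0 : K)).HasBasis (fun _ : ℕ => True)
      fun n => (Carlitz.fracNhd R K (Units.mk0 _ hs ^ n) : Set K) := by
  refine hK.to_hasBasis (fun a _ => ?_) fun n _ => ⟨_, trivial, subset_rfl⟩
  obtain ⟨n, r, hr⟩ := hfrac (a⁻¹ : Kˣ)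
  refine ⟨n, trivial, fun x hx => ?_⟩
  obtain ⟨y, rfl⟩ := Carlitz.mem_fracNhd.mp hx
  refine Carlitz.mem_fracNhd.mpr ⟨r * y, ?_⟩
  rw [map_mul, ← hr]
  simp only [Units.val_inv_eq_inv_val, Units.val_pow_eq_pow_val, Units.val_mk0]
  field_simp

variable [CommRing L] [TopologicalSpace L] [IsTopologicalRing L]

/-- The closure of the image of `R` in `L`. -/
def closureRange (R : Type u) [CommRing R] [Algebra R K] (j : K →+* L) : Subring L :=
  (j.comp (algebraMap R K)).range.topologicalClosure

omit [TopologicalSpace K] in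
lemma mem_closureRange (j : K →+* L) (r : R) : j (algebraMap R K r) ∈ closureRange R j :=
  Subring.le_topologicalClosure _ ⟨r, rfl⟩

omit [TopologicalSpace K] in
lemma closure_image_fracNhd_pow (j : K →+* L) {s : R} (hs : algebraMap R K s ≠ 0) (n : ℕ) :
    closure (j '' Carlitz.fracNhd R K (Units.mk0 _ hs ^ n)) =
      powNhd (closureRange R j) (j (algebraMap R K s)) n := by
  let v : Lˣ := Units.map j.toMonoidHom (Units.mk0 _ hs ^ n)
  have hv : (v : L) = j (algebraMap R K s) ^ n := by simp [v]
  have himage : j '' Carlitz.fracNhd R K (Units.mk0 _ hs ^ n) =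
      Homeomorph.smul v '' Set.range (j.comp (algebraMap R K)) := by
    ext x
    simp [Carlitz.mem_fracNhd, Units.smul_def, hv]
  rw [himage, ← (Homeomorph.smul v).image_closure]
  ext x
  rw [SetLike.mem_coe, mem_powNhd, ← hv]
  rfl

lemma hasBasis_powNhd [T3Space L] (hK : (𝓝 (0 : K)).HasBasis (fun _ : Kˣ => True)
      fun a => (Carlitz.fracNhd R K a : Set K)) {j : K →+* L} (hj : IsDenseInducing j)
    {s : R} (hs : algebraMap R K s ≠ 0)
    (hfrac : ∀ x : K, ∃ (n : ℕ) (r : R), algebraMap R K s ^ n * x = algebraMap R K r) :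
    (𝓝 (0 : L)).HasBasis (fun _ => True)
      fun n => (powNhd (closureRange R j) (j (algebraMap R K s)) n : Set L) := by
  have h := (hasBasis_fracNhd_pow hK hs hfrac).hasBasis_of_isDenseInducing hj
  simpa only [map_zero, closure_image_fracNhd_pow] using h

end Completion

section Coefficients

lemma isUnit_one_sub_pow {R : Type*} [CommRing R] [IsLocalRing R] {s : R}
    (hs : s ∈ IsLocalRing.maximalIdeal R) {n : ℕ} (hn : 0 < n) : IsUnit (1 - s ^ n) :=
  IsLocalRing.isUnit_one_sub_self_of_mem_nonunits _ (Ideal.pow_mem_of_mem _ hs n hn)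

lemma inv_pow_sub_inv {K : Type*} [Field K] {a : K} (ha : a ≠ 0) (n : ℕ) :
    a⁻¹ ^ (n + 1) - a⁻¹ = (a ^ (n + 1))⁻¹ * (1 - a ^ n) := by
  rw [inv_pow]
  field_simp
  ring

variable {k : Type u} [Field k] [Fintype k] {R K : Type u} [CommRing R] [IsLocalRing R] [Field K]
  [Algebra R K] [Algebra (Polynomial k) K]

/-- The denominator `t ^ q ^ (i + 1) - t` in the recursion for the coefficients equals
`s ^ (-q ^ (i + 1))` times a unit of `R`. -/
lemma exists_expCoeff_eq {s : R} (hs : s ∈ IsLocalRing.maximalIdeal R)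
    (hst : algebraMap (Polynomial k) K Polynomial.X * algebraMap R K s = 1) (i : ℕ) :
    ∃ r : R, Carlitz.expCoeff k K i =
      algebraMap R K r * algebraMap R K s ^ (i * Fintype.card k ^ i) := by
  have hs0 : algebraMap R K s ≠ 0 := right_ne_zero_of_mul_eq_one hst
  induction i with
  | zero => exact ⟨1, by simp [Carlitz.expCoeff]⟩
  | succ i ih =>
    obtain ⟨r, hr⟩ := ih
    set q := Fintype.card k with hq
    have hq1 : 1 < q := Fintype.one_lt_card
    obtain ⟨Q, hQ⟩ : ∃ Q, q ^ (i + 1) = Q + 1 + 1 :=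
      Nat.exists_eq_add_of_le' (hq1.trans_le (Nat.le_self_pow i.succ_ne_zero q))
    obtain ⟨w, hw⟩ := isUnit_one_sub_pow hs Q.succ_pos
    have hwinv : algebraMap R K (↑w⁻¹ : R) * (1 - algebraMap R K s ^ (Q + 1)) = 1 := by
      rw [← map_one (algebraMap R K), ← map_pow, ← map_sub, ← hw, ← map_mul, Units.inv_mul]
    have hw0 : 1 - algebraMap R K s ^ (Q + 1) ≠ 0 := right_ne_zero_of_mul_eq_one hwinv
    have hexponent : (i + 1) * q ^ (i + 1) = i * q ^ i * q + (Q + 1 + 1) := by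
      rw [← hQ, pow_succ]
      ring
    refine ⟨r ^ q * ↑w⁻¹, ?_⟩
    rw [Carlitz.expCoeff, ← hq, eq_inv_of_mul_eq_one_left hst, hexponent, hQ, inv_pow_sub_inv hs0,
      hr, map_mul, map_pow, eq_inv_of_mul_eq_one_left hwinv, mul_pow, ← pow_mul]
    field_simp
    ring

end Coefficients

end AdicExp

section InvCoord

open AdicExp Topology

variable {k : Type u} [Field k] {X : Scheme.{u}} [AlgebraicGeometry.IsIntegral X]
  (π : X ⟶ Carlitz.ProjSpace 1 k) [Surjective π] (z : X)

instance : CompleteSpace (Carlitz.Completed π z) :=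
  inferInstanceAs (CompleteSpace (UniformSpace.Completion (Carlitz.FieldAt π z)))

instance : IsUniformAddGroup (Carlitz.Completed π z) :=
  inferInstanceAs (IsUniformAddGroup (UniformSpace.Completion (Carlitz.FieldAt π z)))

instance : Algebra (X.presheaf.stalk z) (Carlitz.FieldAt π z) :=
  inferInstanceAs (Algebra (X.presheaf.stalk z) X.functionField)

/-- The germ `s` is the inverse of the coordinate `t` at a point `z` with `t(z) = ∞`: it lies in
the maximal ideal of `𝒪_{X,z}`, and inverting it turns `𝒪_{X,z}` into the function field. -/
structure IsInvCoord (s : X.presheaf.stalk z) : Prop where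
  mem : s ∈ IsLocalRing.maximalIdeal (X.presheaf.stalk z)
  coord_mul : algebraMap (Polynomial k) (Carlitz.FieldAt π z) Polynomial.X *
    algebraMap (X.presheaf.stalk z) (Carlitz.FieldAt π z) s = 1
  exists_pow_mul (x : Carlitz.FieldAt π z) : ∃ (n : ℕ) (r : X.presheaf.stalk z),
    algebraMap (X.presheaf.stalk z) (Carlitz.FieldAt π z) s ^ n * x = algebraMap _ _ r

namespace IsInvCoord

variable {π z} {s : X.presheaf.stalk z} (hs : IsInvCoord π z s)
include hs

lemma hasBasis : (𝓝 (0 : Carlitz.Completed π z)).HasBasis (fun _ => True)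
    fun n => (powNhd (closureRange (X.presheaf.stalk z) (Carlitz.toCompleted π z))
      (Carlitz.toCompleted π z (algebraMap _ _ s)) n : Set (Carlitz.Completed π z)) := by
  refine hasBasis_powNhd ?_ UniformSpace.Completion.isDenseInducing_coe
    (right_ne_zero_of_mul_eq_one hs.coord_mul) hs.exists_pow_mul
  exact (Carlitz.fracBasis (X.presheaf.stalk z) X.functionField).hasBasis_nhds_zero

lemma exists_sub_mem_closureRange (c : Carlitz.Completed π z) :
    ∃ f : Carlitz.FieldAt π z, Carlitz.toCompleted π z f - c ∈
      closureRange (X.presheaf.stalk z) (Carlitz.toCompleted π z) := by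
  have hopen := (isOpen_of_basis hs.hasBasis 0).preimage (continuous_sub_right c)
  have hc : c - c ∈ powNhd (closureRange (X.presheaf.stalk z) (Carlitz.toCompleted π z))
      (Carlitz.toCompleted π z (algebraMap _ _ s)) 0 := by
    rw [sub_self]
    exact zero_mem _
  obtain ⟨f, hf⟩ := (UniformSpace.Completion.denseRange_coe
    (α := Carlitz.FieldAt π z)).exists_mem_open hopen ⟨c, hc⟩
  obtain ⟨y, hy, hyf⟩ := mem_powNhd.mp hf
  rw [pow_zero, one_mul] at hyf
  exact ⟨f, (congrArg (· ∈ closureRange _ _) hyf).mp hy⟩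

variable [Fintype k]

lemma exists_expTerm_eq : ∃ u : ℕ → Carlitz.Completed π z,
    (∀ i, u i ∈ closureRange (X.presheaf.stalk z) (Carlitz.toCompleted π z)) ∧ u 0 = 1 ∧
    ∀ γ, Carlitz.expTerm π z γ = fun i => u i * Carlitz.toCompleted π z (algebraMap _ _ s) ^
      (i * Fintype.card k ^ i) * γ ^ Fintype.card k ^ i := by
  choose r hr using exists_expCoeff_eq (K := Carlitz.FieldAt π z) hs.mem hs.coord_mul
  refine ⟨fun i => Carlitz.toCompleted π z (algebraMap _ _ (r i)),
    fun i => mem_closureRange _ _, ?_, fun γ => funext fun i => ?_⟩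
  · have h0 := hr 0
    simp only [Carlitz.expCoeff, pow_zero, mul_one] at h0
    exact (congrArg _ h0.symm).trans (map_one _)
  · rw [Carlitz.expTerm, hr, map_mul, map_pow]

lemma summable (γ : Carlitz.Completed π z) : Summable (Carlitz.expTerm π z γ) := by
  obtain ⟨u, hu, -, h⟩ := hs.exists_expTerm_eq
  rw [h]
  exact summable_exp hs.hasBasis (mem_closureRange _ _) hu Fintype.card_pos γ

lemma exists_sub_exp_eq (c : Carlitz.Completed π z) :
    ∃ (f : Carlitz.FieldAt π z) (γ : Carlitz.Completed π z),
      HasSum (Carlitz.expTerm π z γ) (Carlitz.toCompleted π z f - c) := by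
  obtain ⟨u, hu, hu0, h⟩ := hs.exists_expTerm_eq
  obtain ⟨f, hf⟩ := hs.exists_sub_mem_closureRange c
  simp only [h]
  exact ⟨f, exists_hasSum_exp hs.hasBasis (mem_closureRange _ _) hu Fintype.card_pos hu0
    (Carlitz.add_pow_card π z) hf⟩

end IsInvCoord

end InvCoord

section Projective

open HomogeneousLocalization

variable (k : Type u) [Field k]

lemma algebraMap_degreeZero_surjective (n : ℕ) :
    Function.Surjective (algebraMap k (MvPolynomial.homogeneousSubmodule (Fin (n + 1)) k 0)) := by
  rintro ⟨f, hf⟩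
  have hC := MvPolynomial.totalDegree_eq_zero_iff_eq_C.mp
    ((MvPolynomial.totalDegree_zero_iff_isHomogeneous (p := f)).mpr hf)
  exact ⟨_, Subtype.ext hC.symm⟩

instance (n : ℕ) : IsProper (Carlitz.ProjSpace.toSpec n k) := by
  let S := MvPolynomial.homogeneousSubmodule (Fin (n + 1)) k 0
  have : @IsScalarTower k S (MvPolynomial (Fin (n + 1)) k)
      Algebra.toSMul Algebra.toSMul Algebra.toSMul :=
    @IsScalarTower.of_algebraMap_eq k S (MvPolynomial (Fin (n + 1)) k) _ _ _ _ _ _ fun _ => rfl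
  have : Algebra.FiniteType S (MvPolynomial (Fin (n + 1)) k) :=
    Algebra.FiniteType.of_restrictScalars_finiteType k S _
  have : IsClosedImmersion (Spec.map (CommRingCat.ofHom (algebraMap k S))) :=
    IsClosedImmersion.spec_of_surjective _ (algebraMap_degreeZero_surjective k n)
  have : IsProper (Proj.toSpecZero (MvPolynomial.homogeneousSubmodule (Fin (n + 1)) k)) :=
    inferInstance
  exact MorphismProperty.comp_mem @IsProper _ _ this inferInstance

lemma adjoin_degreeZero_range_X :
    Algebra.adjoin (MvPolynomial.homogeneousSubmodule (Fin 2) k 0)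
      (Set.range fun i : Fin 2 => (MvPolynomial.X i : MvPolynomial (Fin 2) k)) = ⊤ := by
  rw [eq_top_iff]
  rintro f -
  induction f using MvPolynomial.induction_on with
  | C a =>
    exact Subalgebra.algebraMap_mem _
      (algebraMap k (MvPolynomial.homogeneousSubmodule (Fin 2) k 0) a)
  | add p q hp hq => exact add_mem hp hq
  | mul_X p i hp => exact mul_mem hp (Algebra.subset_adjoin ⟨i, rfl⟩)

lemma iSup_basicOpen_X :
    ⨆ i : Fin 2, Proj.basicOpen (MvPolynomial.homogeneousSubmodule (Fin 2) k)
      (MvPolynomial.X i) = ⊤ :=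
  Proj.iSup_basicOpen_eq_top' (MvPolynomial.homogeneousSubmodule (Fin 2) k) _
    (fun i => ⟨1, Carlitz.X_mem k i⟩) (adjoin_degreeZero_range_X k)

lemma adjoin_away_X_eq_top (i : Fin 2) :
    Algebra.adjoin (MvPolynomial.homogeneousSubmodule (Fin 2) k 0)
      (Set.range fun j => Away.isLocalizationElem (Carlitz.X_mem k i) (Carlitz.X_mem k j)) = ⊤ := by
  rw [eq_top_iff, ← Away.adjoin_mk_prod_pow_eq_top (Carlitz.X_mem k i) (Fin 2) _
    (adjoin_degreeZero_range_X k) 1 (Carlitz.X_mem k), Algebra.adjoin_le_iff]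
  rintro _ ⟨a, e, he, -, rfl⟩
  have hprod : Away.mk (MvPolynomial.homogeneousSubmodule (Fin 2) k) (Carlitz.X_mem k i) a
      (∏ j, MvPolynomial.X j ^ e j)
      (he ▸ SetLike.prod_pow_mem_graded _ _ _ _ fun j _ => Carlitz.X_mem k j) =
      ∏ j, Away.isLocalizationElem (Carlitz.X_mem k i) (Carlitz.X_mem k j) ^ e j := by
    apply HomogeneousLocalization.val_injective
    have ha : a = e 0 + e 1 := by simpa using he.symm
    subst ha
    simp only [Fin.prod_univ_two, Away.val_mk, pow_add, Away.isLocalizationElem, pow_one, val_mul,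
      val_pow, Localization.mk_pow, SubmonoidClass.mk_pow, Localization.mk_mul,
      Submonoid.mk_mul_mk]
  rw [hprod]
  exact Subalgebra.prod_mem _ fun j _ => pow_mem (Algebra.subset_adjoin (Set.mem_range_self j)) _

instance (i : Fin 2) : IsPrincipalIdealRing
    (Away (MvPolynomial.homogeneousSubmodule (Fin 2) k) (MvPolynomial.X i)) := by
  have : IsPrincipalIdealRing (Polynomial (MvPolynomial.homogeneousSubmodule (Fin 2) k 0)) :=
    IsPrincipalIdealRing.of_surjective (Polynomial.mapRingHom (algebraMap k _))
      (Polynomial.map_surjective _ (algebraMap_degreeZero_surjective k 1))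
  let u := Away.isLocalizationElem (Carlitz.X_mem k i) (Carlitz.X_mem k (1 - i))
  have hu : Algebra.adjoin (MvPolynomial.homogeneousSubmodule (Fin 2) k 0) {u} = ⊤ := by
    rw [eq_top_iff, ← adjoin_away_X_eq_top k i, Algebra.adjoin_le_iff]
    rintro _ ⟨j, rfl⟩
    have hj : j = i ∨ j = 1 - i := by lia
    obtain rfl | rfl := hj
    · have hone : Away.isLocalizationElem (Carlitz.X_mem k j) (Carlitz.X_mem k j) = 1 := by
        apply HomogeneousLocalization.val_injective
        simp [Away.isLocalizationElem]
      simp only [SetLike.mem_coe, hone, one_mem]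
    · exact Algebra.subset_adjoin rfl
  rw [Algebra.adjoin_singleton_eq_range_aeval, AlgHom.range_eq_top] at hu
  exact IsPrincipalIdealRing.of_surjective _ hu

end Projective

section Dimension

/-- Topological spaces of dimension at most one, in terms of points: there is no chain of two
proper specializations. -/
def DimLEOne (T : Type*) [TopologicalSpace T] : Prop :=
  ∀ ⦃x y z : T⦄, x ⤳ y → y ⤳ z → x = y ∨ y = z

lemma isField_sections {k : Type u} [Field k] {U : (Spec (.of k)).Opens} (hU : U ≠ ⊥) :
    IsField Γ(Spec (.of k), U) := by
  obtain rfl := (Opens.eq_bot_or_top U).resolve_left hU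
  exact (Scheme.ΓSpecIso (.of k)).commRingCatIsoToRingEquiv.toMulEquiv.isField (Field.toIsField k)

namespace DimLEOne

lemma of_continuous {S T : Type*} [TopologicalSpace S] [TopologicalSpace T] {f : S → T}
    (hf : Continuous f) (hfiber : ∀ ⦃x y⦄, x ⤳ y → f x = f y → x = y) (h : DimLEOne T) :
    DimLEOne S :=
  fun _ _ _ hxy hyz => (h (hxy.map hf) (hyz.map hf)).imp (hfiber hxy) (hfiber hyz)

lemma of_openEmbeddings {T : Type*} [TopologicalSpace T]
    (h : ∀ z : T, ∃ (S : Type u) (_ : TopologicalSpace S) (f : S → T),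
      Topology.IsOpenEmbedding f ∧ z ∈ Set.range f ∧ DimLEOne S) : DimLEOne T := by
  intro x y z hxy hyz
  obtain ⟨S, _, f, hf, ⟨c, rfl⟩, hdim⟩ := h z
  obtain ⟨b, rfl⟩ := hyz.mem_open hf.isOpen_range ⟨c, rfl⟩
  obtain ⟨a, rfl⟩ := hxy.mem_open hf.isOpen_range ⟨b, rfl⟩
  exact (hdim (hf.isInducing.specializes_iff.mp hxy) (hf.isInducing.specializes_iff.mp hyz)).imp
    (congrArg f) (congrArg f)

lemma primeSpectrum (R : Type*) [CommRing R] [Ring.KrullDimLE 1 R] :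
    DimLEOne (PrimeSpectrum R) := by
  intro x y z hxy hyz
  rw [← PrimeSpectrum.le_iff_specializes] at hxy hyz
  obtain hmin | hmax := Ring.krullDimLE_one_iff.mp ‹_› y.asIdeal y.isPrime
  · exact .inl (le_antisymm hxy (hmin.2 ⟨x.isPrime, bot_le⟩ hxy))
  · exact .inr (PrimeSpectrum.ext (hmax.eq_of_le z.isPrime.ne_top hyz))

lemma of_locallyQuasiFinite {X Y : Scheme.{u}} (f : X ⟶ Y) [LocallyQuasiFinite f]
    (h : DimLEOne Y) : DimLEOne X :=
  h.of_continuous f.continuous fun _ y hxy e =>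
    (f.isDiscrete_preimage_singleton (f y)).eq_of_specializes hxy e rfl

lemma projectiveLine (k : Type u) [Field k] : DimLEOne (Carlitz.ProjSpace 1 k) := by
  refine of_openEmbeddings fun z => ?_
  have hz : z ∈ ⨆ i : Fin 2, Proj.basicOpen (MvPolynomial.homogeneousSubmodule (Fin 2) k)
      (MvPolynomial.X i) := by
    rw [iSup_basicOpen_X]
    trivial
  obtain ⟨i, hi⟩ := Opens.mem_iSup.mp hz
  let f := Proj.awayι (MvPolynomial.homogeneousSubmodule (Fin 2) k) _ (Carlitz.X_mem k i) one_pos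
  exact ⟨_, _, f, f.isOpenEmbedding, (Proj.opensRange_awayι _ _ _ _).ge hi, primeSpectrum _⟩

lemma of_etale_mvPolynomial {R B : Type u} [CommRing R] [CommRing B] (hR : IsField R)
    {g : MvPolynomial (Fin 1) R →+* B} (hg : g.Etale) : DimLEOne (PrimeSpectrum B) := by
  let _ := hR.toField
  have : IsPrincipalIdealRing (MvPolynomial (Fin 1) R) :=
    IsPrincipalIdealRing.of_surjective (MvPolynomial.uniqueAlgEquiv R (Fin 1)).symm
      (MvPolynomial.uniqueAlgEquiv R (Fin 1)).symm.surjective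
  have hqf : g.QuasiFinite := by
    algebraize [g]
    have : Algebra.Etale (MvPolynomial (Fin 1) R) B := hg
    exact inferInstanceAs (Algebra.QuasiFinite (MvPolynomial (Fin 1) R) B)
  have : LocallyQuasiFinite (Spec.map (CommRingCat.ofHom g)) :=
    HasRingHomProperty.Spec_iff.mpr hqf
  exact of_locallyQuasiFinite (Spec.map (CommRingCat.ofHom g)) (primeSpectrum _)

lemma of_smoothOfRelativeDimension_one {k : Type u} [Field k] {X : Scheme.{u}}
    (p : X ⟶ Spec (.of k)) [SmoothOfRelativeDimension 1 p] : DimLEOne X := by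
  refine of_openEmbeddings fun z => ?_
  obtain ⟨U, hU, V, hV, hz, hVU, hp⟩ :=
    SmoothOfRelativeDimension.exists_isStandardSmoothOfRelativeDimension (n := 1) (f := p) z
  obtain ⟨g, -, hg⟩ := hp.exists_etale_mvPolynomial
  have hUbot : U ≠ ⊥ := by
    rintro rfl
    exact hVU hz
  exact ⟨_, _, hV.fromSpec, hV.fromSpec.isOpenEmbedding, by rwa [hV.range_fromSpec],
    of_etale_mvPolynomial (isField_sections hUbot) hg⟩

end DimLEOne

end Dimension

section Curve

lemma isLocallyNoetherian_of_locallyOfFiniteType {k : Type u} [Field k] {X : Scheme.{u}}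
    (p : X ⟶ Spec (.of k)) [LocallyOfFiniteType p] : IsLocallyNoetherian X := by
  refine isLocallyNoetherian_of_affine_cover (S := id) (iSup_affineOpens_eq_top X) fun V => ?_
  have hfin := p.finiteType_appLE (isAffineOpen_top _) V.2 le_top
  have : IsNoetherianRing Γ(Spec (.of k), ⊤) :=
    IsLocallyNoetherian.component_noetherian ⟨⊤, isAffineOpen_top _⟩
  algebraize [(p.appLE ⊤ V.1 le_top).hom]
  exact Algebra.FiniteType.isNoetherianRing Γ(Spec (.of k), ⊤) Γ(X, V.1)

lemma noetherianSpace_of_isProper {k : Type u} [Field k] {n : ℕ} {X : Scheme.{u}}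
    (f : X ⟶ Carlitz.ProjSpace n k) [IsProper f] : NoetherianSpace X := by
  let p := f ≫ Carlitz.ProjSpace.toSpec n k
  have := isLocallyNoetherian_of_locallyOfFiniteType p
  have := QuasiCompact.compactSpace_of_compactSpace p
  have : IsNoetherian X := {}
  infer_instance

namespace DimLEOne

variable {X : Scheme.{u}} [AlgebraicGeometry.IsIntegral X] (hX : DimLEOne X)
include hX

lemma eq_of_specializes {x z : X} (hxz : x ⤳ z) (hx : x ≠ genericPoint X) : x = z :=
  (hX ((genericPoint_spec X).specializes trivial) hxz).resolve_left hx.symm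

lemma isClosed_singleton {x : X} (hx : x ≠ genericPoint X) : IsClosed ({x} : Set X) := by
  rw [← closure_eq_iff_isClosed]
  refine Set.Subset.antisymm (fun y hy => ?_) subset_closure
  exact (hX.eq_of_specializes (specializes_iff_mem_closure.mpr hy) hx).symm

variable [NoetherianSpace X]

lemma finite_of_isClosed {Z : Set X} (hZ : IsClosed Z) (hg : genericPoint X ∉ Z) : Z.Finite := by
  obtain ⟨S, hS, hcl, hirr, rfl⟩ := NoetherianSpace.exists_finite_set_isClosed_irreducible hZ
  refine Set.Finite.sUnion hS fun T hT => ?_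
  have hgen := (hirr T hT).isGenericPoint_genericPoint (hcl T hT)
  have hne : (hirr T hT).genericPoint ≠ genericPoint X := fun e => hg (e ▸ ⟨T, hT, hgen.mem⟩)
  rw [← hgen.def, (hX.isClosed_singleton hne).closure_eq]
  exact Set.finite_singleton _

lemma exists_nhd_subset {V : X.Opens} (hV : genericPoint X ∈ V) (z : X) :
    ∃ W : X.Opens, z ∈ W ∧ ∀ x ∈ W, x ∈ V ∨ x = z := by
  have hfin : ((V : Set X)ᶜ \ {z}).Finite :=
    (hX.finite_of_isClosed V.isOpen.isClosed_compl fun h => h hV).subset Set.sdiff_subset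
  have hcl : IsClosed ((V : Set X)ᶜ \ {z}) := by
    rw [← Set.biUnion_of_singleton ((V : Set X)ᶜ \ {z})]
    exact hfin.isClosed_biUnion fun x hx => hX.isClosed_singleton fun e => hx.1 (e ▸ hV)
  refine ⟨⟨_, hcl.isOpen_compl⟩, fun h => h.2 rfl, fun x hx => ?_⟩
  by_contra! h
  exact hx h

variable {Y : Scheme.{u}} [Nontrivial Y] (f : X ⟶ Y) [IsProper f] [Surjective f]

lemma finite_preimage_singleton (y : Y) : (f ⁻¹' {y}).Finite := by
  by_cases hy : IsClosed ({y} : Set Y)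
  · refine hX.finite_of_isClosed (hy.preimage f.continuous) fun (hg : f (genericPoint X) = y) => ?_
    obtain ⟨y', hy'⟩ := exists_ne y
    obtain ⟨x, rfl⟩ := f.surjective y'
    have hspec := ((genericPoint_spec X).specializes (Set.mem_univ x)).map f.continuous
    exact hy' ((hg ▸ hspec).mem_closed hy rfl)
  · refine (Set.finite_singleton (genericPoint X)).subset fun x hx => ?_
    by_contra hne
    have hclosed := f.isClosedMap _ (hX.isClosed_singleton hne)
    rw [Set.image_singleton, Set.mem_singleton_iff.mp hx] at hclosed
    exact hy hclosed

lemma isFinite_of_isProper : IsFinite f := by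
  have := LocallyQuasiFinite.of_finite_preimage_singleton (f := f) (hX.finite_preimage_singleton f)
  exact IsFinite.of_isProper_of_locallyQuasiFinite f

end DimLEOne

instance (k : Type u) [Field k] : Nontrivial (Carlitz.ProjSpace 1 k) := by
  let 𝒜 := MvPolynomial.homogeneousSubmodule (Fin 2) k
  have hprime : Prime (MvPolynomial.X 0 : MvPolynomial (Fin 2) k) := MvPolynomial.X_prime
  have hirr (i : Fin 2) : MvPolynomial.X i ∈ HomogeneousIdeal.irrelevant 𝒜 :=
    HomogeneousIdeal.mem_irrelevant_of_mem 𝒜 one_pos (Carlitz.X_mem k i)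
  have hbot : (MvPolynomial.X 0 : MvPolynomial (Fin 2) k) ∉ (⊥ : HomogeneousIdeal 𝒜) := by
    rw [← HomogeneousIdeal.mem_iff, HomogeneousIdeal.toIdeal_bot]
    exact hprime.ne_zero
  let generic : ProjectiveSpectrum 𝒜 :=
    { asHomogeneousIdeal := ⊥
      isPrime := HomogeneousIdeal.toIdeal_bot (𝒜 := 𝒜) ▸ inferInstance
      not_irrelevant_le := fun h => hbot (h (hirr 0)) }
  let infty : ProjectiveSpectrum 𝒜 :=
    { asHomogeneousIdeal := ⟨Ideal.span {MvPolynomial.X 0}, Ideal.homogeneous_span 𝒜 _ (by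
        rintro _ rfl
        exact ⟨1, Carlitz.X_mem k 0⟩)⟩
      isPrime := (Ideal.span_singleton_prime hprime.ne_zero).mpr hprime
      not_irrelevant_le := fun h => by
        have hdvd := Ideal.mem_span_singleton.mp (h (hirr 1))
        simp [MvPolynomial.X_dvd_X] at hdvd }
  refine ⟨generic, infty, fun h => hbot ?_⟩
  change MvPolynomial.X 0 ∈ generic.asHomogeneousIdeal
  rw [h]
  exact Ideal.mem_span_singleton_self _

lemma isFinite_of_smoothOfRelativeDimension_one {k : Type u} [Field k] {X : Scheme.{u}}
    [AlgebraicGeometry.IsIntegral X] {p : X ⟶ Spec (.of k)} [SmoothOfRelativeDimension 1 p]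
    (hp : Carlitz.IsProjective p) {π : X ⟶ Carlitz.ProjSpace 1 k}
    (hπ : π ≫ Carlitz.ProjSpace.toSpec 1 k = p) [Surjective π] : IsFinite π := by
  have : IsProper (π ≫ Carlitz.ProjSpace.toSpec 1 k) := by
    obtain ⟨n, i, hi, rfl⟩ := hp
    rw [hπ]
    infer_instance
  have := IsProper.of_comp π (Carlitz.ProjSpace.toSpec 1 k)
  have := noetherianSpace_of_isProper π
  exact (DimLEOne.of_smoothOfRelativeDimension_one p).isFinite_of_isProper π

lemma isAffineOpen_finitePart {k : Type u} [Field k] {X : Scheme.{u}}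
    (π : X ⟶ Carlitz.ProjSpace 1 k) [IsAffineHom π] : IsAffineOpen (Carlitz.finitePart π) := by
  have hline : IsAffineOpen (Carlitz.affineLine k) :=
    Proj.isAffineOpen_basicOpen (MvPolynomial.homogeneousSubmodule (Fin 2) k) _
      (Carlitz.X_mem k 0) one_pos
  exact hline.preimage π

end Curve

section InvCoord

open HomogeneousLocalization

variable (k : Type u) [Field k]

/-- The affine line `D₊(x₁)`, which contains the point at infinity `x₀ = 0`. -/
def affineLineAtInfty : (Carlitz.ProjSpace 1 k).Opens :=
  Proj.basicOpen (MvPolynomial.homogeneousSubmodule (Fin 2) k) (MvPolynomial.X 1)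

/-- The inverse coordinate `x₀ / x₁` as an element of `(k[x₀, x₁][1/x₁])₀`. -/
def invCoordAway : Away (MvPolynomial.homogeneousSubmodule (Fin 2) k)
    (MvPolynomial.X (1 : Fin 2)) :=
  Away.mk (MvPolynomial.homogeneousSubmodule (Fin 2) k)
    (d := 1) (Carlitz.X_mem k 1) 1 (MvPolynomial.X 0)
    (by simpa only [one_smul] using Carlitz.X_mem k 0)

/-- The inverse coordinate `x₀ / x₁` as a regular function on `affineLineAtInfty`. -/
def invCoord : Γ(Carlitz.ProjSpace 1 k, affineLineAtInfty k) :=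
  (Proj.awayToSection (MvPolynomial.homogeneousSubmodule (Fin 2) k) (MvPolynomial.X 1)).hom
    (invCoordAway k)

lemma polyToSections_X : Carlitz.polyToSections k Polynomial.X =
    (Proj.awayToSection (MvPolynomial.homogeneousSubmodule (Fin 2) k) (MvPolynomial.X 0)).hom
      (Carlitz.coordAway k) := by
  change (Proj.awayToSection (MvPolynomial.homogeneousSubmodule (Fin 2) k) (MvPolynomial.X 0)).hom
    (Polynomial.eval₂ _ (Carlitz.coordAway k) Polynomial.X) = _
  rw [Polynomial.eval₂_X]

variable {k}

lemma mem_affineLineAtInfty {y : Carlitz.ProjSpace 1 k} (hy : y ∉ Carlitz.affineLine k) :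
    y ∈ affineLineAtInfty k := by
  obtain ⟨i, hi⟩ := Opens.mem_iSup.mp ((iSup_basicOpen_X k).ge (trivial : y ∈ ⊤))
  fin_cases i
  exacts [absurd hi hy, hi]

lemma notMem_basicOpen_invCoord {y : Carlitz.ProjSpace 1 k} (hy : y ∉ Carlitz.affineLine k) :
    y ∉ (Carlitz.ProjSpace 1 k).basicOpen (invCoord k) := by
  let 𝒜 := MvPolynomial.homogeneousSubmodule (Fin 2) k
  let x : ProjectiveSpectrum 𝒜 := y
  have hy1 := mem_affineLineAtInfty hy
  rw [Scheme.mem_basicOpen _ _ _ hy1]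
  intro hunit
  have hgerm : Proj.stalkIso' 𝒜 x
      ((Carlitz.ProjSpace 1 k).presheaf.germ (affineLineAtInfty k) y hy1 (invCoord k)) =
    mapId 𝒜 (Submonoid.powers_le.mpr hy1) (invCoordAway k) :=
    Proj.stalkIso'_germ 𝒜 _ _ _ _
  have hval : (mapId 𝒜 (Submonoid.powers_le.mpr hy1) (invCoordAway k)).val =
      Localization.mk (MvPolynomial.X 0) ⟨MvPolynomial.X 1 ^ 1,
        Submonoid.pow_mem x.asHomogeneousIdeal.toIdeal.primeCompl hy1 1⟩ := rfl
  have hstalk : IsUnit (Proj.stalkIso' 𝒜 x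
      ((Carlitz.ProjSpace 1 k).presheaf.germ (affineLineAtInfty k) y hy1 (invCoord k))) :=
    hunit.map (Proj.stalkIso' 𝒜 x)
  rw [hgerm, ← isUnit_iff_isUnit_val, hval, Localization.mk_eq_mk',
    IsLocalization.AtPrime.isUnit_mk'_iff _ x.asHomogeneousIdeal.toIdeal] at hstalk
  exact hy hstalk

lemma res_coord_mul_res_invCoord :
    (Carlitz.ProjSpace 1 k).presheaf.map
      (homOfLE (inf_le_left : Carlitz.affineLine k ⊓ affineLineAtInfty k ≤ _)).op
      (Carlitz.polyToSections k Polynomial.X) *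
    (Carlitz.ProjSpace 1 k).presheaf.map
      (homOfLE (inf_le_right : Carlitz.affineLine k ⊓ affineLineAtInfty k ≤ _)).op
      (invCoord k) = 1 := by
  rw [polyToSections_X]
  apply Subtype.ext
  funext x
  apply HomogeneousLocalization.val_injective
  let 𝒜 := MvPolynomial.homogeneousSubmodule (Fin 2) k
  let y : ProjectiveSpectrum 𝒜 := x.1
  have h0 : MvPolynomial.X 0 ∈ y.asHomogeneousIdeal.toIdeal.primeCompl := x.2.1
  have h1 : MvPolynomial.X 1 ∈ y.asHomogeneousIdeal.toIdeal.primeCompl := x.2.2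
  change (mapId 𝒜 (Submonoid.powers_le.mpr h0) (Carlitz.coordAway k) *
      mapId 𝒜 (Submonoid.powers_le.mpr h1) (invCoordAway k)).val =
    (1 : AtPrime 𝒜 y.asHomogeneousIdeal.toIdeal).val
  rw [val_mul, val_one]
  change Localization.mk (MvPolynomial.X 1) ⟨MvPolynomial.X 0 ^ 1, Submonoid.pow_mem _ h0 1⟩ *
    Localization.mk (MvPolynomial.X 0) ⟨MvPolynomial.X 1 ^ 1, Submonoid.pow_mem _ h1 1⟩ = 1
  rw [Localization.mk_mul, ← Localization.mk_one, Localization.mk_eq_mk_iff,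
    Localization.r_iff_exists]
  refine ⟨1, ?_⟩
  simp only [OneMemClass.coe_one, Submonoid.coe_mul]
  ring

end InvCoord

section LocalRing

variable {X : Scheme.{u}} [AlgebraicGeometry.IsIntegral X]

namespace DimLEOne

lemma eq_maximalIdeal_of_ne_bot (hX : DimLEOne X) {z : X} {P : Ideal (X.presheaf.stalk z)}
    [hP : P.IsPrime] (hne : P ≠ ⊥) : P = IsLocalRing.maximalIdeal (X.presheaf.stalk z) := by
  let f : PrimeSpectrum (X.presheaf.stalk z) → X := X.fromSpecStalk z
  have hf : Topology.IsEmbedding f := (X.fromSpecStalk z).isEmbedding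
  let a : PrimeSpectrum (X.presheaf.stalk z) := ⟨P, hP⟩
  have hgen : f a ≠ genericPoint X := by
    intro h
    have hspec : f a ⤳ f ⊥ := h ▸ (genericPoint_spec X).specializes trivial
    have hle : a ≤ ⊥ := (PrimeSpectrum.le_iff_specializes _ _).mpr (hf.specializes_iff.mp hspec)
    exact hne (le_bot_iff.mp hle)
  have hclosed := (IsLocalRing.specializes_closedPoint a).map hf.continuous
  exact congrArg PrimeSpectrum.asIdeal (hf.injective (hX.eq_of_specializes hclosed hgen))

lemma exists_pow_mul_eq (hX : DimLEOne X) {z : X} {s : X.presheaf.stalk z}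
    (hs : s ∈ IsLocalRing.maximalIdeal (X.presheaf.stalk z)) (x : X.functionField) :
    ∃ (n : ℕ) (r : X.presheaf.stalk z),
      algebraMap (X.presheaf.stalk z) X.functionField s ^ n * x = algebraMap _ _ r := by
  obtain ⟨a, b, hb, rfl⟩ := IsFractionRing.div_surjective (A := X.presheaf.stalk z) x
  have hb0 : b ≠ 0 := nonZeroDivisors.ne_zero hb
  have hrad : s ∈ (Ideal.span {b}).radical := by
    rw [Ideal.radical_eq_sInf, Ideal.mem_sInf]
    rintro P ⟨hbP, hP⟩
    have hbP' : b ∈ P := hbP (Ideal.mem_span_singleton_self b)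
    rw [hX.eq_maximalIdeal_of_ne_bot (P := P) (by rintro rfl; exact hb0 hbP')]
    exact hs
  obtain ⟨n, hn⟩ := hrad
  obtain ⟨c, hc⟩ := Ideal.mem_span_singleton.mp hn
  have hb1 : algebraMap (X.presheaf.stalk z) X.functionField b ≠ 0 :=
    (map_ne_zero_iff _ (IsFractionRing.injective _ _)).mpr hb0
  refine ⟨n, a * c, ?_⟩
  rw [← map_pow, hc, map_mul, map_mul]
  field_simp

end DimLEOne

variable {k : Type u} [Field k] (π : X ⟶ Carlitz.ProjSpace 1 k)

omit [AlgebraicGeometry.IsIntegral X] in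
lemma res_coord_mul_res_app_invCoord :
    X.presheaf.map (homOfLE (inf_le_left :
        Carlitz.finitePart π ⊓ π ⁻¹ᵁ affineLineAtInfty k ≤ Carlitz.finitePart π)).op
      (Carlitz.polyToSec π (Carlitz.finitePart π) le_rfl Polynomial.X) *
    X.presheaf.map (homOfLE (inf_le_right :
        Carlitz.finitePart π ⊓ π ⁻¹ᵁ affineLineAtInfty k ≤ π ⁻¹ᵁ affineLineAtInfty k)).op
      (π.app (affineLineAtInfty k) (invCoord k)) = 1 := by
  have hX : Carlitz.polyToSec π (Carlitz.finitePart π) le_rfl Polynomial.X =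
      π.app (Carlitz.affineLine k) (Carlitz.polyToSections k Polynomial.X) := by
    simp only [Carlitz.polyToSec, Carlitz.finitePart, Scheme.Hom.appLE_eq_app]
    rfl
  have happ := congrArg (π.app (Carlitz.affineLine k ⊓ affineLineAtInfty k))
    (res_coord_mul_res_invCoord (k := k))
  have hleft := ConcreteCategory.congr_hom (π.naturality (homOfLE (inf_le_left :
    Carlitz.affineLine k ⊓ affineLineAtInfty k ≤ _)).op) (Carlitz.polyToSections k Polynomial.X)
  have hright := ConcreteCategory.congr_hom (π.naturality (homOfLE (inf_le_right :
    Carlitz.affineLine k ⊓ affineLineAtInfty k ≤ _)).op) (invCoord k)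
  rw [ConcreteCategory.comp_apply, ConcreteCategory.comp_apply] at hleft hright
  rw [map_mul, map_one, hleft, hright] at happ
  rw [hX]
  exact happ

variable {π} [Surjective π]

lemma coord_mul_germ_invCoord {z : X} (hz : z ∈ π ⁻¹ᵁ affineLineAtInfty k) :
    algebraMap (Polynomial k) (Carlitz.FieldAt π z) Polynomial.X *
      algebraMap (X.presheaf.stalk z) (Carlitz.FieldAt π z)
        (X.presheaf.germ _ z hz (π.app (affineLineAtInfty k) (invCoord k))) = 1 := by
  let V : X.Opens := π ⁻¹ᵁ affineLineAtInfty k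
  have : Nonempty V := ⟨⟨z, hz⟩⟩
  change X.presheaf.germ (Carlitz.finitePart π) (genericPoint X) _
    (Carlitz.polyToSec π (Carlitz.finitePart π) le_rfl Polynomial.X) *
    algebraMap (X.presheaf.stalk z) X.functionField (X.presheaf.germ V z hz _) = 1
  have hgen : genericPoint X ∈ Carlitz.finitePart π ⊓ V :=
    ⟨Carlitz.genericPoint_mem_finitePart π, Carlitz.genericPoint_mem hz⟩
  rw [Scheme.algebraMap_germ_eq_germToFunctionField,
    ← X.presheaf.germ_res_apply (homOfLE (inf_le_left : Carlitz.finitePart π ⊓ V ≤ _)) _ hgen,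
    Scheme.germToFunctionField,
    ← X.presheaf.germ_res_apply (homOfLE (inf_le_right : Carlitz.finitePart π ⊓ V ≤ _)) _ hgen,
    ← map_mul]
  exact (congrArg _ (res_coord_mul_res_app_invCoord π)).trans (map_one _)

lemma DimLEOne.exists_isInvCoord (hX : DimLEOne X) {z : X} (hz : z ∉ Carlitz.finitePart π) :
    ∃ s, IsInvCoord π z s := by
  have hzV : z ∈ π ⁻¹ᵁ affineLineAtInfty k := mem_affineLineAtInfty hz
  let s := X.presheaf.germ _ z hzV (π.app (affineLineAtInfty k) (invCoord k))
  have hs : s ∈ IsLocalRing.maximalIdeal (X.presheaf.stalk z) := by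
    rw [IsLocalRing.mem_maximalIdeal, mem_nonunits_iff, ← Scheme.mem_basicOpen]
    intro h
    exact notMem_basicOpen_invCoord hz ((Scheme.preimage_basicOpen π (invCoord k)).ge h)
  exact ⟨s, hs, coord_mul_germ_invCoord hzV, hX.exists_pow_mul_eq hs⟩

end LocalRing

section Regular

variable {X : Scheme.{u}} [AlgebraicGeometry.IsIntegral X]

/-- The rational function `φ` on an integral scheme is regular on the nonempty open set `V`. -/
def IsRegularOn (V : X.Opens) (φ : X.functionField) : Prop :=
  ∃ (h : genericPoint X ∈ V) (s : Γ(X, V)), X.presheaf.germ V (genericPoint X) h s = φ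

lemma exists_isRegularOn (φ : X.functionField) : ∃ V : X.Opens, IsRegularOn V φ :=
  X.presheaf.exists_germ_eq φ

namespace IsRegularOn

variable {V W : X.Opens} {φ ψ : X.functionField}

lemma mono (h : IsRegularOn V φ) (hW : W ≤ V) (hg : genericPoint X ∈ W) : IsRegularOn W φ := by
  obtain ⟨hV, s, rfl⟩ := h
  exact ⟨hg, X.presheaf.map (homOfLE hW).op s, X.presheaf.germ_res_apply (homOfLE hW) _ hg s⟩

lemma add (h : IsRegularOn V φ) (h' : IsRegularOn V ψ) : IsRegularOn V (φ + ψ) := by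
  obtain ⟨hV, s, rfl⟩ := h
  obtain ⟨_, s', rfl⟩ := h'
  exact ⟨hV, s + s', map_add _ _ _⟩

lemma mul (h : IsRegularOn V φ) (h' : IsRegularOn V ψ) : IsRegularOn V (φ * ψ) := by
  obtain ⟨hV, s, rfl⟩ := h
  obtain ⟨_, s', rfl⟩ := h'
  exact ⟨hV, s * s', map_mul _ _ _⟩

lemma pow (h : IsRegularOn V φ) (n : ℕ) : IsRegularOn V (φ ^ n) := by
  obtain ⟨hV, s, rfl⟩ := h
  exact ⟨hV, s ^ n, map_pow _ _ _⟩

lemma sum (hV : genericPoint X ∈ V) {ι : Type*} (t : Finset ι) {φ : ι → X.functionField}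
    (h : ∀ i ∈ t, IsRegularOn V (φ i)) : IsRegularOn V (∑ i ∈ t, φ i) :=
  Finset.sum_induction _ _ (fun _ _ => add) ⟨hV, 0, map_zero _⟩ h

lemma exists_pow_mul (hV : IsAffineOpen V) {c : Γ(X, V)} (h : IsRegularOn (X.basicOpen c) φ) :
    ∃ N, ∃ hg : genericPoint X ∈ V,
      IsRegularOn V (X.presheaf.germ V (genericPoint X) hg c ^ N * φ) := by
  obtain ⟨hc, s, rfl⟩ := h
  have hg := X.basicOpen_le c hc
  have := hV.isLocalization_basicOpen c
  obtain ⟨⟨a, ⟨_, N, rfl⟩⟩, ha⟩ := IsLocalization.surj (Submonoid.powers c) s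
  have hgerm (y : Γ(X, V)) : X.presheaf.germ (X.basicOpen c) (genericPoint X) hc
      (algebraMap Γ(X, V) Γ(X, X.basicOpen c) y) = X.presheaf.germ V (genericPoint X) hg y :=
    X.presheaf.germ_res_apply (homOfLE (X.basicOpen_le c)) _ hc y
  refine ⟨N, hg, hg, a, ?_⟩
  have hmul := congrArg (X.presheaf.germ (X.basicOpen c) (genericPoint X) hc) ha
  rw [map_mul, hgerm, hgerm, map_pow] at hmul
  rw [← hmul, mul_comm]

end IsRegularOn

variable {Y : X.Opens} (hY : IsAffineOpen Y)
include hY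

lemma exists_pow_mul_isRegularOn_basicOpen (hg : genericPoint X ∈ Y) {b c : Γ(X, Y)}
    {φ : X.functionField} (h : IsRegularOn (X.basicOpen b ⊓ X.basicOpen c) φ) :
    ∃ N, ∀ n ≥ N,
      IsRegularOn (X.basicOpen b) (X.presheaf.germ Y (genericPoint X) hg c ^ n * φ) := by
  let c' : Γ(X, X.basicOpen b) := X.presheaf.map (homOfLE (X.basicOpen_le b)).op c
  have hc' : X.basicOpen c' = X.basicOpen b ⊓ X.basicOpen c := X.basicOpen_res c _
  obtain ⟨N, hb, hN⟩ := (hc'.symm ▸ h : IsRegularOn (X.basicOpen c') φ).exists_pow_mul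
    (hY.basicOpen b)
  have hgerm : X.presheaf.germ (X.basicOpen b) _ hb c' = X.presheaf.germ Y _ hg c :=
    X.presheaf.germ_res_apply (homOfLE (X.basicOpen_le b)) _ hb c
  refine ⟨N, fun n hn => ?_⟩
  obtain ⟨d, rfl⟩ := Nat.exists_eq_add_of_le' hn
  rw [pow_add, mul_assoc, ← hgerm]
  exact (IsRegularOn.pow ⟨hb, c', rfl⟩ d).mul hN

/-- The first Cousin problem, solved by `g = ∑ j, c j * b j ^ M * φ j` for a partition of unity
`∑ j, c j * b j ^ M = 1` in which `M` is so large that `b j ^ M` clears the poles of `φ i - φ j`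
on the basic open set of `b i`. -/
lemma exists_sub_isRegularOn_basicOpen (hg : genericPoint X ∈ Y) {ι : Type*} [Finite ι]
    {b : ι → Γ(X, Y)} (hb : ⨆ i, X.basicOpen (b i) = Y) {φ : ι → X.functionField}
    (hφ : ∀ i j, IsRegularOn (X.basicOpen (b i) ⊓ X.basicOpen (b j)) (φ i - φ j)) :
    ∃ g : X.functionField, ∀ i, IsRegularOn (X.basicOpen (b i)) (φ i - g) := by
  have := Fintype.ofFinite ι
  let G := X.presheaf.germ Y (genericPoint X) hg
  have hN (i j : ι) : ∃ N, ∀ n ≥ N,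
      IsRegularOn (X.basicOpen (b i)) (G (b j) ^ n * (φ i - φ j)) :=
    exists_pow_mul_isRegularOn_basicOpen hY hg (hφ i j)
  choose N hN using hN
  obtain ⟨M, hM⟩ : ∃ M, ∀ i j, N i j ≤ M :=
    ⟨Finset.univ.sup fun ij : ι × ι => N ij.1 ij.2, fun i j =>
      Finset.le_sup (f := fun ij : ι × ι => N ij.1 ij.2) (Finset.mem_univ (i, j))⟩
  have hspan : Ideal.span (Set.range fun i => b i ^ M) = ⊤ := by
    rw [Set.range_comp' (· ^ M) b]
    refine Ideal.span_pow_eq_top _ (hY.iSup_basicOpen_eq_self_iff.mp ?_) M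
    rwa [iSup_range']
  obtain ⟨c, hc⟩ := Ideal.mem_span_range_iff_exists_fun.mp ((Ideal.eq_top_iff_one _).mp hspan)
  have hone : ∑ j, G (c j) * G (b j) ^ M = 1 := by simpa using congrArg G hc
  refine ⟨∑ j, G (c j) * G (b j) ^ M * φ j, fun i => ?_⟩
  have hsub : φ i - ∑ j, G (c j) * G (b j) ^ M * φ j =
      ∑ j, G (c j) * (G (b j) ^ M * (φ i - φ j)) := by
    nth_rewrite 1 [← one_mul (φ i), ← hone, Finset.sum_mul]
    rw [← Finset.sum_sub_distrib]
    exact Finset.sum_congr rfl fun j _ => by ring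
  have hi : genericPoint X ∈ X.basicOpen (b i) := (hφ i i).choose.1
  rw [hsub]
  exact .sum hi _ fun j _ => .mul (.mono ⟨hg, c j, rfl⟩ (X.basicOpen_le _) hi) (hN i j M (hM i j))

lemma exists_sub_isRegularOn (hg : genericPoint X ∈ Y) (U : X → X.Opens) (hU : ∀ x, x ∈ U x)
    (φ : X → X.functionField)
    (hφ : ∀ x ∈ Y, ∀ y ∈ Y, IsRegularOn (U x ⊓ U y ⊓ Y) (φ x - φ y)) :
    ∃ g : X.functionField, ∀ y ∈ Y, ∃ V : X.Opens, y ∈ V ∧ V ≤ U y ∧ IsRegularOn V (φ y - g) := by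
  have hbasic (y : Y) : ∃ b : Γ(X, Y), X.basicOpen b ≤ U y ⊓ Y ∧ y.1 ∈ X.basicOpen b :=
    hY.exists_basicOpen_le (V := U y ⊓ Y) ⟨y.1, hU y, y.2⟩ y.2
  choose b hbU hyb using hbasic
  have hgen (y : Y) : genericPoint X ∈ X.basicOpen (b y) := Carlitz.genericPoint_mem (hyb y)
  obtain ⟨t, ht⟩ := hY.isCompact.elim_nhds_subcover' (fun y hy => X.basicOpen (b ⟨y, hy⟩))
    fun y hy => (X.basicOpen (b ⟨y, hy⟩)).isOpen.mem_nhds (hyb ⟨y, hy⟩)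
  have hcover : ⨆ i : t, X.basicOpen (b i) = Y := by
    refine le_antisymm (iSup_le fun i => X.basicOpen_le _) fun y hy => ?_
    obtain ⟨i, hi, hyi⟩ := Set.mem_iUnion₂.mp (ht hy)
    exact Opens.mem_iSup.mpr ⟨⟨i, hi⟩, hyi⟩
  obtain ⟨g, hg'⟩ := exists_sub_isRegularOn_basicOpen hY hg hcover (φ := fun i => φ i)
    fun i j => (hφ _ i.1.2 _ j.1.2).mono
      (le_inf (inf_le_inf ((hbU _).trans inf_le_left) ((hbU _).trans inf_le_left))
        (inf_le_left.trans (X.basicOpen_le _))) ⟨hgen _, hgen _⟩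
  refine ⟨g, fun y hy => ?_⟩
  obtain ⟨i, hi⟩ := Opens.mem_iSup.mp (hcover.ge hy)
  have hgen' : genericPoint X ∈ U y ⊓ X.basicOpen (b i) :=
    ⟨Carlitz.genericPoint_mem (hU y), hgen _⟩
  refine ⟨U y ⊓ X.basicOpen (b i), ⟨hU y, hi⟩, inf_le_left, ?_⟩
  rw [← sub_add_sub_cancel _ (φ i)]
  refine ((hφ y hy _ i.1.2).mono ?_ hgen').add ((hg' i).mono inf_le_right hgen')
  exact le_inf (inf_le_inf_left _ ((hbU _).trans inf_le_left))
    (inf_le_right.trans (X.basicOpen_le _))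

end Regular

namespace CarlitzSequence

open Carlitz

section Sheaves

variable {k : Type u} [Field k] {X : Scheme.{u}} (π : X ⟶ ProjSpace 1 k)

lemma existsUnique_gluing_inf (Y : X.Opens) {ι : Type*} (U : ι → X.Opens)
    (c : ∀ i, Γ(X, U i ⊓ Y))
    (hc : ∀ i j, X.presheaf.map (homOfLE (inf_le_inf_right Y inf_le_left)).op (c i) =
      X.presheaf.map (homOfLE (inf_le_inf_right Y (inf_le_right : U i ⊓ U j ≤ U j))).op (c j)) :
    ∃! c₀ : Γ(X, iSup U ⊓ Y), ∀ i,
      X.presheaf.map (homOfLE (inf_le_inf_right Y (le_iSup U i))).op c₀ = c i := by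
  refine X.sheaf.existsUnique_gluing' (fun i => U i ⊓ Y) (iSup U ⊓ Y)
    (fun i => homOfLE (inf_le_inf_right Y (le_iSup U i))) (iSup_inf_eq U Y).le c fun i j => ?_
  have hle : (U i ⊓ Y) ⊓ (U j ⊓ Y) ≤ (U i ⊓ U j) ⊓ Y :=
    le_inf (inf_le_inf inf_le_left inf_le_left) (inf_le_left.trans inf_le_right)
  have hres := congrArg (X.presheaf.map (homOfLE hle).op) (hc i j)
  rw [← ConcreteCategory.comp_apply, ← ConcreteCategory.comp_apply, ← Functor.map_comp,
    ← Functor.map_comp] at hres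
  exact hres

variable {π} in
lemma existsUnique_gluing_inftyIn {M : AtInfty π → Type*} {ι : Type*} (U : ι → X.Opens)
    (s : ∀ i, ∀ z : InftyIn π (U i), M z.1)
    (hs : ∀ i j (z : InftyIn π (U i ⊓ U j)), s i ⟨z.1, z.2.1⟩ = s j ⟨z.1, z.2.2⟩) :
    ∃! σ : ∀ z : InftyIn π (iSup U), M z.1, ∀ i (z : InftyIn π (U i)),
      σ ⟨z.1, le_iSup U i z.2⟩ = s i z := by
  choose idx hidx using fun z : InftyIn π (iSup U) => Opens.mem_iSup.mp z.2
  exact ⟨fun z => s (idx z) ⟨z.1, hidx z⟩, fun i z => hs _ i ⟨z.1, hidx _, z.2⟩,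
    fun τ hτ => funext fun z => hτ (idx z) ⟨z.1, hidx z⟩⟩

variable [AlgebraicGeometry.IsIntegral X] [Surjective π] [Fintype k]

/-- The presheaf `U ↦ C₀(U ∩ Y) × ∏_{z ∈ U \ Y} K_z`. -/
def pairsPresheaf : TopCat.Presheaf (ModuleCat.{u} (Polynomial k)) X where
  obj U := ModuleCat.of (Polynomial k) (Pairs π U.unop)
  map {U V} f := ModuleCat.ofHom (Pairs.res π f.unop.le)
  map_id U := by
    refine ModuleCat.hom_ext (LinearMap.ext fun s => Prod.ext ?_ rfl)
    exact ConcreteCategory.congr_hom (X.presheaf.map_id _) s.1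
  map_comp {U V W} f g := by
    refine ModuleCat.hom_ext (LinearMap.ext fun s => Prod.ext ?_ rfl)
    exact ConcreteCategory.congr_hom (X.presheaf.map_comp
      (homOfLE (inf_le_inf_right (finitePart π) f.unop.le)).op
      (homOfLE (inf_le_inf_right (finitePart π) g.unop.le)).op) s.1

lemma pairsPresheaf_isSheaf : (pairsPresheaf (k := k) π).IsSheaf := by
  rw [TopCat.Presheaf.isSheaf_iff_isSheafUniqueGluing]
  intro ι U s hs
  obtain ⟨c, hc, hc_unique⟩ := existsUnique_gluing_inf (finitePart π) U (fun i => (s i).1)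
    fun i j => congrArg Prod.fst (hs i j)
  obtain ⟨γ, hγ, hγ_unique⟩ := existsUnique_gluing_inftyIn (M := fun z => Completed π z.1) U
    (fun i => (s i).2) fun i j => congrFun (congrArg Prod.snd (hs i j))
  exact ⟨(c, γ), fun i => Prod.ext (hc i) (funext (hγ i)), fun τ hτ =>
    Prod.ext (hc_unique τ.1 fun i => congrArg Prod.fst (hτ i))
      (hγ_unique τ.2 fun i => congrFun (congrArg Prod.snd (hτ i)))⟩

/-- The sheaf `U ↦ C₀(U ∩ Y) × ∏_{z ∈ U \ Y} K_z`. -/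
def pairsSheaf : ModuleSheaf (Polynomial k) (X : TopCat) :=
  ⟨pairsPresheaf π, pairsPresheaf_isSheaf π⟩

/-- The presheaf `U ↦ ∏_{z ∈ U \ Y} C₀(K_z)`. -/
def inftyPresheaf : TopCat.Presheaf (ModuleCat.{u} (Polynomial k)) X where
  obj U := ModuleCat.of (Polynomial k) (∀ z : InftyIn π U.unop, C0 k (Completed π z.1.1))
  map {U V} f := ModuleCat.ofHom
    { toFun := fun c z => c ⟨z.1, f.unop.le z.2⟩
      map_add' := fun _ _ => rfl
      map_smul' := fun _ _ => rfl }

lemma inftyPresheaf_isSheaf : (inftyPresheaf (k := k) π).IsSheaf := by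
  rw [TopCat.Presheaf.isSheaf_iff_isSheafUniqueGluing]
  intro ι U s hs
  obtain ⟨c, hc, hc_unique⟩ := existsUnique_gluing_inftyIn
    (M := fun z => C0 k (Completed π z.1)) U s fun i j => congrFun (hs i j)
  exact ⟨c, fun i => funext (hc i), fun τ hτ => hc_unique τ fun i => congrFun (hτ i)⟩

/-- The sheaf `U ↦ ∏_{z ∈ U \ Y} C₀(K_z)`. -/
def inftySheaf : ModuleSheaf (Polynomial k) (X : TopCat) :=
  ⟨inftyPresheaf π, inftyPresheaf_isSheaf π⟩

end Sheaves

variable {k : Type u} [Field k] [Fintype k] {X : Scheme.{u}} [AlgebraicGeometry.IsIntegral X]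
  {π : X ⟶ ProjSpace 1 k} [Surjective π]

section Exp

variable {z : X} (hz : ∀ γ, Summable (expTerm π z γ))
include hz

lemma isExp_iff (γ : Completed π z) (c : C0 k (Completed π z)) :
    IsExp π z γ c ↔ exp π z γ = c := by
  constructor
  · intro h
    exact congrArg (toC0 k (Completed π z)) (HasSum.tsum_eq (f := expTerm π z γ) h)
  · rintro rfl
    exact (hz γ).hasSum

/-- The Carlitz exponential as a `k[t]`-linear map `K_z → C₀(K_z)`, when it converges on `K_z`. -/
def expLinear : Completed π z →ₗ[Polynomial k] C0 k (Completed π z) where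
  toFun := exp π z
  map_add' _ _ := (isExp_iff hz _ _).mp
    (((isExp_iff hz _ _).mpr rfl).add ((isExp_iff hz _ _).mpr rfl))
  map_smul' a _ := (isExp_iff hz _ _).mp (((isExp_iff hz _ _).mpr rfl).smul a)

end Exp

section Rational

/-- The rational function on `X` given by the first component of a pair `(c, γ)`. -/
def rationalPart {U : X.Opens} (hU : genericPoint X ∈ U) :
    Pairs (k := k) π U →+ X.functionField :=
  ((X.presheaf.germ (U ⊓ finitePart π) (genericPoint X)
    ⟨hU, genericPoint_mem_finitePart π⟩).hom.toAddMonoidHom.comp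
      (toC0 k (Sec π (U ⊓ finitePart π) inf_le_right)).symm.toAddMonoidHom).comp
        (AddMonoidHom.fst _ _)

variable {U : X.Opens} (hU : genericPoint X ∈ U)

lemma rationalPart_res {V : X.Opens} (h : V ≤ U) (hV : genericPoint X ∈ V) (s : Pairs π U) :
    rationalPart hV (Pairs.res π h s) = rationalPart (h hV) s :=
  X.presheaf.germ_res_apply (homOfLE (inf_le_inf_right (finitePart π) h)) _ _ _

lemma localize_eq_rationalPart (s : Pairs π U) (z : InftyIn π U) : localize π z s.1 =
    toC0 k _ (toCompleted π z.1.1 (rationalPart (genericPoint_mem z.2) s)) := rfl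

lemma pairs_ext {s s' : Pairs π U} (h : rationalPart hU s = rationalPart hU s')
    (h' : s.2 = s'.2) : s = s' :=
  Prod.ext (germ_injective_of_isIntegral (X := X) _ _ h) h'

lemma isRegularOn_rationalPart (s : Pairs π U) :
    IsRegularOn (U ⊓ finitePart π) (rationalPart hU s) :=
  ⟨⟨hU, genericPoint_mem_finitePart π⟩, s.1, rfl⟩

lemma exists_rationalPart_eq {φ : X.functionField} (hφ : IsRegularOn (U ⊓ finitePart π) φ)
    (γ : ∀ z : InftyIn π U, Completed π z.1.1) :
    ∃ s : Pairs π U, s.2 = γ ∧ ∀ hU : genericPoint X ∈ U, rationalPart hU s = φ := by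
  obtain ⟨_, c, hc⟩ := hφ
  exact ⟨(c, γ), rfl, fun _ => hc⟩

end Rational

variable (H : ∀ (z : AtInfty π) (γ : Completed π z.1), Summable (expTerm π z.1 γ))

/-- The map `δ : (c, γ) ↦ (c - exp γ_z)_z` on sections over `U`. -/
def diffOn (U : X.Opens) :
    Pairs π U →ₗ[Polynomial k] ∀ z : InftyIn π U, C0 k (Completed π z.1.1) :=
  LinearMap.pi fun z => (localize π z).comp (LinearMap.fst _ _ _) -
    (expLinear (H z.1)).comp ((LinearMap.proj z).comp (LinearMap.snd _ _ _))

lemma diffOn_apply (U : X.Opens) (s : Pairs π U) (z : InftyIn π U) :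
    diffOn H U s z = localize π z s.1 - exp π z.1.1 (s.2 z) := rfl

lemma diffOn_eq_zero_iff (U : X.Opens) (s : Pairs π U) :
    diffOn H U s = 0 ↔ s ∈ carlitzSections π U := by
  rw [funext_iff]
  refine forall_congr' fun z => ?_
  rw [diffOn_apply, isExp_iff (H z.1), Pi.zero_apply, sub_eq_zero, eq_comm]

variable (π) in
/-- The inclusion of `C` into the sheaf of pairs. -/
def incl : carlitzSheaf (k := k) π ⟶ pairsSheaf π :=
  ⟨{ app := fun U => ModuleCat.ofHom (carlitzSections π U.unop).subtype
     naturality := fun _ _ _ => rfl }⟩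

/-- The morphism of sheaves `δ : (c, γ) ↦ (c - exp γ_z)_z`. -/
def diff : pairsSheaf (k := k) π ⟶ inftySheaf π :=
  ⟨{ app := fun U => ModuleCat.ofHom (diffOn H U.unop)
     naturality := fun U V f => by
      refine ModuleCat.hom_ext (LinearMap.ext fun s => funext fun z => ?_)
      exact congrArg (fun c => c - exp π z.1.1 (s.2 ⟨z.1, f.unop.le z.2⟩))
        (localize_res π f.unop.le s z) }⟩

/-- The sequence `0 → C → C₀(U ∩ Y) × ∏ K_z → ∏ C₀(K_z) → 0` of sheaves. -/
def sheafSequence : ShortComplex (ModuleSheaf (Polynomial k) (X : TopCat)) :=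
  ShortComplex.mk (incl π) (diff H) (by
    apply ObjectProperty.hom_ext
    refine NatTrans.ext (funext fun U => ModuleCat.hom_ext (LinearMap.ext fun s => ?_))
    exact (diffOn_eq_zero_iff H U.unop s.1).mpr s.2)

lemma mono_incl : Mono (incl (k := k) π) := by
  have h : Mono ((sheafToPresheaf _ _).map (incl (k := k) π)) := by
    rw [NatTrans.mono_iff_mono_app]
    exact fun U => (ModuleCat.mono_iff_injective _).mpr Subtype.val_injective
  exact (sheafToPresheaf _ _).mono_of_mono_map h

lemma sheafSequence_exact : (sheafSequence H).Exact := by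
  have : Mono (sheafSequence H).f := mono_incl
  refine ShortComplex.exact_of_f_is_kernel _
    (Limits.KernelFork.IsLimit.ofι' _ (sheafSequence H).zero fun {W} g hg => ?_)
  have hg' (U t) : g.hom.app U t ∈ carlitzSections π U.unop :=
    (diffOn_eq_zero_iff H U.unop _).mp
      (congrArg (fun φ : W ⟶ inftySheaf π => φ.hom.app U t) hg)
  exact ⟨⟨{ app := fun U => ModuleCat.ofHom ((g.hom.app U).hom.codRestrict _ (hg' U))
            naturality := fun U V f => by
              refine ModuleCat.hom_ext (LinearMap.ext fun s => Subtype.ext ?_)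
              exact ConcreteCategory.congr_hom (g.hom.naturality f) s }⟩, rfl⟩

variable [NoetherianSpace X] (hX : DimLEOne X)
include hX

omit [Fintype k] in
lemma exists_isRegularOn_nhd {U : X.Opens} {z : X} (hz : z ∉ finitePart π) (hzU : z ∈ U)
    (φ : X.functionField) :
    ∃ V ≤ U, z ∈ V ∧ (∀ y ∈ V, y ∉ finitePart π → y = z) ∧
      IsRegularOn (V ⊓ finitePart π) φ := by
  obtain ⟨W, hW⟩ := exists_isRegularOn φ
  obtain ⟨V, hzV, hV⟩ :=
    hX.exists_nhd_subset (V := W ⊓ finitePart π) ⟨hW.choose, genericPoint_mem_finitePart π⟩ z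
  refine ⟨V ⊓ U, inf_le_right, ⟨hzV, hzU⟩, fun y hy hyY => ?_, hW.mono (fun y hy => ?_) ?_⟩
  · exact (hV y hy.1).resolve_left fun h => hyY h.2
  · exact ((hV y hy.1.1).resolve_right fun h => hz (h ▸ hy.2)).1
  · exact ⟨⟨genericPoint_mem hzV, genericPoint_mem hzU⟩, genericPoint_mem_finitePart π⟩

variable (hexp : ∀ (z : AtInfty π) (c : Completed π z.1),
  ∃ (f : FieldAt π z.1) (γ : Completed π z.1),
    HasSum (expTerm π z.1 γ) (toCompleted π z.1 f - c))
include hexp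

lemma exists_diffOn_eq {U : X.Opens} (q : ∀ z : InftyIn π U, C0 k (Completed π z.1.1))
    (x : InftyIn π U) :
    ∃ (V : X.Opens) (hV : V ≤ U) (_ : x.1.1 ∈ V) (σ : Pairs π V),
      ∀ z : InftyIn π V, diffOn H V σ z = q ⟨z.1, hV z.2⟩ := by
  obtain ⟨f, γ, hγ⟩ := hexp x.1 ((toC0 k _).symm (q x))
  have hexp_γ : exp π x.1.1 γ = toC0 k _ (toCompleted π x.1.1 f) - q x :=
    (isExp_iff (H x.1) _ _).mp hγ
  obtain ⟨V, hVU, hxV, hV, hf⟩ := exists_isRegularOn_nhd hX x.1.2 x.2 f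
  have hunique (z : InftyIn π V) : z = ⟨x.1, hxV⟩ :=
    Subtype.ext (Subtype.ext (hV z.1.1 z.2 z.1.2))
  obtain ⟨σ, hσγ, hσf⟩ := exists_rationalPart_eq hf fun z => hunique z ▸ γ
  refine ⟨V, hVU, hxV, σ, fun z => ?_⟩
  obtain rfl := hunique z
  rw [diffOn_apply, localize_eq_rationalPart, hσf, hσγ, hexp_γ, sub_sub_cancel]

lemma epi_diff : Epi (diff H) := by
  refine (TopCat.Sheaf.isLocallySurjective_iff_epi (diff H)).mp ?_
  rw [TopCat.Presheaf.isLocallySurjective_iff]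
  intro U q x hx
  by_cases hxY : x ∈ finitePart π
  · refine ⟨U ⊓ finitePart π, inf_le_left, ⟨(0 : Pairs π (U ⊓ finitePart π)), ?_⟩, hx, hxY⟩
    exact funext fun z : InftyIn π (U ⊓ finitePart π) => absurd z.2.2 z.1.2
  · obtain ⟨V, hV, hxV, σ, hσ⟩ := exists_diffOn_eq H hX hexp q ⟨⟨x, hxY⟩, hx⟩
    exact ⟨V, hV, ⟨σ, funext hσ⟩, hxV⟩

lemma sheafSequence_shortExact : (sheafSequence H).ShortExact where
  exact := sheafSequence_exact H
  mono_f := mono_incl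
  epi_g := epi_diff H hX hexp

end CarlitzSequence

namespace CarlitzSequence

open Carlitz

variable {k : Type u} [Field k] [Fintype k] {X : Scheme.{u}} [AlgebraicGeometry.IsIntegral X]
  {π : X ⟶ ProjSpace 1 k} [Surjective π]

section Acyclic

omit [Fintype k] [Surjective π] in
lemma genericPoint_mem_inf {V W : X.Opens} {x y : X} (hx : x ∈ V) (hy : y ∈ W) :
    genericPoint X ∈ V ⊓ W :=
  ⟨genericPoint_mem hx, genericPoint_mem hy⟩

variable [NoetherianSpace X] (hX : DimLEOne X) (hY : IsAffineOpen (finitePart π))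
  {U : X → X.Opens} (hU : ∀ x, x ∈ U x)
  {f : ∀ x y, Pairs (k := k) π (U x ⊓ U y)}
  (hf : ModuleSheaf.IsCocycle (pairsSheaf π) U f)
include hU hf

omit [NoetherianSpace X] in
lemma rationalPart_add_of_isCocycle (x y z : X) :
    rationalPart (genericPoint_mem_inf (hU x) (hU y)) (f x y) +
      rationalPart (genericPoint_mem_inf (hU y) (hU z)) (f y z) =
    rationalPart (genericPoint_mem_inf (hU x) (hU z)) (f x z) := by
  let W : X.Opens := U x ⊓ U y ⊓ U z
  have hW : genericPoint X ∈ W :=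
    ⟨genericPoint_mem_inf (hU x) (hU y), genericPoint_mem (hU z)⟩
  have hcocycle : Pairs.res π inf_le_left (f x y) +
      Pairs.res π (le_inf (inf_le_left.trans inf_le_right) inf_le_right) (f y z) =
      Pairs.res π (V := W) (le_inf (inf_le_left.trans inf_le_left) inf_le_right) (f x z) :=
    hf x y z W (inf_le_left.trans inf_le_left) (inf_le_left.trans inf_le_right) inf_le_right
  have hsum := congrArg (rationalPart hW) hcocycle
  rwa [map_add, rationalPart_res, rationalPart_res, rationalPart_res] at hsum

include hX hY in
lemma exists_sub_eq_rationalPart : ∃ φ : X → X.functionField,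
    (∀ x y, φ x - φ y =
      rationalPart (genericPoint_mem_inf (hU x) (hU y)) (f x y)) ∧
    ∀ x, ∃ V ≤ U x, x ∈ V ∧ IsRegularOn (V ⊓ finitePart π) (φ x) := by
  let ψ (x : X) : X.functionField :=
    rationalPart (genericPoint_mem_inf (hU x) (hU (genericPoint X))) (f x (genericPoint X))
  have hψ (x y) : ψ x - ψ y =
      rationalPart (genericPoint_mem_inf (hU x) (hU y)) (f x y) :=
    sub_eq_iff_eq_add.mpr (rationalPart_add_of_isCocycle hU hf _ _ _).symm
  obtain ⟨g, hg⟩ := exists_sub_isRegularOn hY (genericPoint_mem_finitePart π) U hU ψ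
    fun x _ y _ => hψ x y ▸ isRegularOn_rationalPart _ _
  refine ⟨fun x => ψ x - g, fun x y => (sub_sub_sub_cancel_right _ _ _).trans (hψ x y),
    fun x => ?_⟩
  by_cases hx : x ∈ finitePart π
  · obtain ⟨V, hxV, hVU, hV⟩ := hg x hx
    exact ⟨V, hVU, hxV,
      hV.mono inf_le_left ⟨genericPoint_mem hxV, genericPoint_mem_finitePart π⟩⟩
  · obtain ⟨V, hVU, hxV, -, hV⟩ := exists_isRegularOn_nhd hX hx (hU x) (ψ x - g)
    exact ⟨V, hVU, hxV, hV⟩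

omit hU hf in
include hX hY in
lemma pairsSheaf_cechAcyclic : ModuleSheaf.CechAcyclic (pairsSheaf (k := k) π) := by
  intro U hU (f : ∀ x y, Pairs π (U x ⊓ U y)) hf
  obtain ⟨φ, hφ, hreg⟩ := exists_sub_eq_rationalPart hX hY hU hf
  choose V hVU hxV hV using hreg
  choose g hgγ hgφ using fun x => exists_rationalPart_eq (hV x) fun z =>
    (f x z.1.1).2 ⟨z.1, hVU x z.2, hU z.1.1⟩
  refine ⟨V, hVU, g, hxV, fun x y => ?_⟩
  suffices hsub : Pairs.res π (inf_le_inf (hVU x) (hVU y)) (f x y) =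
      (Pairs.res π inf_le_left (g x) - Pairs.res π inf_le_right (g y) : Pairs π (V x ⊓ V y)) from
    hsub
  have hgen : genericPoint X ∈ V x ⊓ V y := genericPoint_mem_inf (hxV x) (hxV y)
  refine pairs_ext hgen ?_ (funext fun z : InftyIn π (V x ⊓ V y) => ?_)
  · rw [map_sub, rationalPart_res, rationalPart_res, rationalPart_res, hgφ, hgφ, hφ]
  · have hcocycle := congrFun (congrArg Prod.snd (hf x y z.1.1 (U x ⊓ U y ⊓ U z.1.1)
      (inf_le_left.trans inf_le_left) (inf_le_left.trans inf_le_right) inf_le_right))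
      ⟨z.1, ⟨hVU x z.2.1, hVU y z.2.2⟩, hU z.1.1⟩
    refine (eq_sub_of_add_eq hcocycle).trans ?_
    exact congrArg₂ (· - ·) (congrFun (hgγ x) ⟨z.1, z.2.1⟩).symm
      (congrFun (hgγ y) ⟨z.1, z.2.2⟩).symm

end Acyclic

section Global

omit [Fintype k] [AlgebraicGeometry.IsIntegral X] [Surjective π] in
variable (π) in
lemma res_top_inf_bijective : Function.Bijective
    (Sec.res π inf_le_right le_rfl (le_inf le_top le_rfl) :
      Sec π (⊤ ⊓ finitePart π) inf_le_right → Sec π (finitePart π) le_rfl) := by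
  let i : finitePart π ⟶ ⊤ ⊓ finitePart π := homOfLE (le_inf le_top le_rfl)
  have : IsIso i := ⟨homOfLE inf_le_right, rfl, rfl⟩
  exact ConcreteCategory.bijective_of_isIso (X.presheaf.map i.op)

variable (π) in
/-- The identification `(C₀(X ∩ Y) × ∏_z K_z) = (C₀(Y) × ∏_z K_z)` for the sections over `X` of
the sheaf of pairs. -/
def pairsTop : Pairs (k := k) π ⊤ ≃ₗ[Polynomial k]
    C0Y (k := k) π × ∀ z : AtInfty π, Completed π z.1 :=
  (LinearEquiv.ofBijective (C0.map k (Sec.res π inf_le_right le_rfl (le_inf le_top le_rfl)))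
    (res_top_inf_bijective π)).prodCongr
    { toFun := fun γ z => γ ⟨z, trivial⟩
      invFun := fun γ z => γ z.1
      map_add' := fun _ _ => rfl
      map_smul' := fun _ _ => rfl
      left_inv := fun _ => rfl
      right_inv := fun _ => rfl }

variable (π) in
/-- The identification of the sections over `X` of the sheaf `U ↦ ∏_{z ∈ U \ Y} C₀(K_z)`. -/
def inftyTop : (∀ z : InftyIn π ⊤, C0 k (Completed π z.1.1)) ≃ₗ[Polynomial k]
    ∀ z : AtInfty π, C0 k (Completed π z.1) where
  toFun c z := c ⟨z, trivial⟩
  invFun c z := c z.1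
  map_add' _ _ := rfl
  map_smul' _ _ := rfl
  left_inv _ := rfl
  right_inv _ := rfl

lemma globalInclusion_injective : Function.Injective (globalInclusion (k := k) π) := fun _ _ h =>
  Subtype.ext ((pairsTop π).injective h)

variable (H : ∀ (z : AtInfty π) (γ : Completed π z.1), Summable (expTerm π z.1 γ))

/-- The map `δ : (c, γ) ↦ (c - exp γ_z)_z` on `C₀(Y) × ∏_z K_z`. -/
def globalDiff : (C0Y (k := k) π × ∀ z : AtInfty π, Completed π z.1) →ₗ[Polynomial k]
    ∀ z : AtInfty π, C0 k (Completed π z.1) :=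
  LinearMap.pi fun z => (localizeY π z.1).comp (LinearMap.fst _ _ _) -
    (expLinear (H z)).comp ((LinearMap.proj z).comp (LinearMap.snd _ _ _))

lemma globalDiff_comp_pairsTop :
    globalDiff H ∘ₗ pairsTop π = inftyTop π ∘ₗ diffOn H ⊤ := by
  refine LinearMap.ext fun s => funext fun z => ?_
  exact congrArg (fun c => toC0 k (Completed π z.1) c - exp π z.1 (s.2 ⟨z, trivial⟩))
    (Sec.toCompleted_res π z.1 inf_le_right le_rfl (le_inf le_top le_rfl)
      (genericPoint_mem_finitePart π) s.1)

lemma exact_globalInclusion_globalDiff :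
    Function.Exact (globalInclusion (k := k) π) (globalDiff H) := by
  have hexact : Function.Exact (carlitzSections π ⊤).subtype (diffOn H ⊤) := fun s => by
    rw [diffOn_eq_zero_iff, Submodule.coe_subtype, Subtype.range_coe, SetLike.mem_coe]
  exact hexact.of_ladder_linearEquiv_of_exact (e₁ := .refl _ _) (e₂ := pairsTop π)
    (e₃ := inftyTop π) rfl (globalDiff_comp_pairsTop H)

variable (hS : (sheafSequence H).ShortExact)

/-- The connecting homomorphism `∏_z C₀(K_z) → H¹(X, C)`. -/
def globalConnecting :
    (∀ z : AtInfty π, C0 k (Completed π z.1)) →ₗ[Polynomial k] cohomology (carlitzSheaf π) 1 :=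
  ModuleSheaf.connecting hS ∘ₗ (inftyTop π).symm.toLinearMap

lemma exact_globalDiff_globalConnecting :
    Function.Exact (globalDiff H) (globalConnecting H hS) :=
  (ModuleSheaf.exact_app_connecting hS).of_ladder_linearEquiv_of_exact (e₁ := pairsTop π)
    (e₂ := inftyTop π) (e₃ := .refl _ _) (globalDiff_comp_pairsTop H) rfl

lemma globalConnecting_surjective [Subsingleton (cohomology (sheafSequence H).X₂ 1)] :
    Function.Surjective (globalConnecting H hS) :=
  (ModuleSheaf.connecting_surjective hS).comp (inftyTop π).symm.surjective

end Global

end CarlitzSequence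

end

theorem lemma4_general {k : Type u} [Field k] [Fintype k] {X : Scheme.{u}}
    [AlgebraicGeometry.IsIntegral X] (π : X ⟶ Carlitz.ProjSpace 1 k) [IsFinite π] [Surjective π] :
    (∀ (z : Carlitz.AtInfty π) (γ : Carlitz.Completed π z.1),
      Summable (Carlitz.expTerm π z.1 γ)) ∧
    ∃ (δ : (Carlitz.C0Y π × ∀ z : Carlitz.AtInfty π, Carlitz.Completed π z.1) →ₗ[Polynomial k]
          ∀ z : Carlitz.AtInfty π, Carlitz.C0 k (Carlitz.Completed π z.1))
      (d : (∀ z : Carlitz.AtInfty π, Carlitz.C0 k (Carlitz.Completed π z.1)) →ₗ[Polynomial k]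
          Carlitz.cohomology (Carlitz.carlitzSheaf (k := k) π) 1),
      (∀ c γ z, δ (c, γ) z = Carlitz.localizeY π z.1 c - Carlitz.exp π z.1 (γ z)) ∧
      Function.Injective (Carlitz.globalInclusion (k := k) π) ∧
      Function.Exact (Carlitz.globalInclusion (k := k) π) δ ∧
      Function.Exact δ d ∧
      Function.Surjective d := by
  have hX : DimLEOne X := DimLEOne.of_locallyQuasiFinite π (DimLEOne.projectiveLine k)
  have : NoetherianSpace X := noetherianSpace_of_isProper π
  choose s hs using fun z : Carlitz.AtInfty π => hX.exists_isInvCoord z.2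
  have H (z : Carlitz.AtInfty π) := (hs z).summable
  have hS : (CarlitzSequence.sheafSequence H).ShortExact :=
    CarlitzSequence.sheafSequence_shortExact H hX fun z => (hs z).exists_sub_exp_eq
  have : Subsingleton (Carlitz.cohomology (CarlitzSequence.sheafSequence H).X₂ 1) :=
    (CarlitzSequence.pairsSheaf_cechAcyclic hX
      (isAffineOpen_finitePart π)).subsingleton_cohomology_one
  exact ⟨H, CarlitzSequence.globalDiff H, CarlitzSequence.globalConnecting H hS,
    fun _ _ _ => rfl, CarlitzSequence.globalInclusion_injective,
    CarlitzSequence.exact_globalInclusion_globalDiff H,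
    CarlitzSequence.exact_globalDiff_globalConnecting H hS,
    CarlitzSequence.globalConnecting_surjective H hS⟩

theorem lemma4 {k : Type u} [Field k] [Fintype k] {X : Scheme.{u}} [AlgebraicGeometry.IsIntegral X]
    (p : X ⟶ Spec (.of k)) [SmoothOfRelativeDimension 1 p] [GeometricallyConnected p]
    (hp : Carlitz.IsProjective p)
    (π : X ⟶ Carlitz.ProjSpace 1 k) (hπ : π ≫ Carlitz.ProjSpace.toSpec 1 k = p) [Surjective π] :
    (∀ (z : Carlitz.AtInfty π) (γ : Carlitz.Completed π z.1),
      Summable (Carlitz.expTerm π z.1 γ)) ∧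
    ∃ (δ : (Carlitz.C0Y π × ∀ z : Carlitz.AtInfty π, Carlitz.Completed π z.1) →ₗ[Polynomial k]
          ∀ z : Carlitz.AtInfty π, Carlitz.C0 k (Carlitz.Completed π z.1))
      (d : (∀ z : Carlitz.AtInfty π, Carlitz.C0 k (Carlitz.Completed π z.1)) →ₗ[Polynomial k]
          Carlitz.cohomology (Carlitz.carlitzSheaf (k := k) π) 1),
      (∀ c γ z, δ (c, γ) z = Carlitz.localizeY π z.1 c - Carlitz.exp π z.1 (γ z)) ∧
      Function.Injective (Carlitz.globalInclusion (k := k) π) ∧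
      Function.Exact (Carlitz.globalInclusion (k := k) π) δ ∧
      Function.Exact δ d ∧
      Function.Surjective d := by
  have := isFinite_of_smoothOfRelativeDimension_one hp hπ
  exact lemma4_general π
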